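/- Let $\Omega\subset\mathbb R^d$ be a bounded convex open set, $T>0$, $s\ge 1$, $0<\theta_1,\dots,\theta_s\le 1$, $a_1>0$, $a_2,\dots,a_s\ge 0$, $1<\alpha_1,\dots,\alpha_d\le 2$, and let $\varepsilon_l^{\pm}\ge 0$ $(1\le l\le d)$ be constants. For $x\in\Omega$ let $x_{l,L}(x)$ and $x_{l,R}(x)$ be the smallest and the largest $l$-th coordinate of the points of $\overline\Omega$ on the line through $x$ parallel to the $l$-th axis, and write $v(x;\xi)$ for the value of $v$ at the point obtained from $x$ by replacing its $l$-th coordinate by $\xi$. For $1<\alpha<2$ put $$\frac{\partial_+^{\alpha}v}{\partial x_{l,+}^{\alpha}}(x)=\frac1{\Gamma(2-\alpha)}\int_{x_{l,L}(x)}^{x_l}\frac{\partial_\xi^2 v(x;\xi)}{(x_l-\xi)^{\alpha-1}}\,d\xi,\qquad \frac{\partial_-^{\alpha}v}{\partial x_{l,-}^{\alpha}}(x)=\frac1{\Gamma(2-\alpha)}\int_{x_l}^{x_{l,R}(x)}\frac{\partial_\xi^2 v(x;\xi)}{(\xi-x_l)^{\alpha-1}}\,d\xi,$$ and let both be $\partial^2v/\partial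 x_l^2$ if $\alpha=2$. Put $$Av=\sum_{l=1}^d\Big(\varepsilon_l^+\frac{\partial_+^{\alpha_l}v}{\partial x_{l,+}^{\alpha_l}}+\varepsilon_l^-\frac{\partial_-^{\alpha_l}v}{\partial x_{l,-}^{\alpha_l}}\Big).$$ Let ${}^C_0D_t^{\theta}w(t)=\frac1{\Gamma(1-\theta)}\int_0^t\frac{w'(\xi)}{(t-\xi)^{\theta}}\,d\xi$ for $0<\theta<1$ and ${}^C_0D_t^{1}w=w'$. Call a function $v$ on $\overline\Omega$ *regular* if it is continuous on $\overline\Omega$ and $C^2$ in $\Omega$, if $\partial^2 v/\partial x_l^2$ is integrable along every chord $\{y\in\Omega:\ y_j=x_j\ (j\ne l)\}$, $x\in\Omega$, $1\le l\le d$, and if $\partial_\pm^{\alpha_l}v/\partial x_{l,\pm}^{\alpha_l}\in L^2(\Omega)$ for all $l$. We say that $\partial v/\partial x_l=0$ on $\partial\Omega$ if $\partial v/\partial x_l(y)\to 0$ as $y\to x$, $y\in\Omega$, for every $x\in\partial\Omega$. Let $u$ be a classical solution of $$\sum_{r=1}^s a_r\,{}^C_0D_t^{\theta_r}u-Au=f\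 \text{ in }\Omega\times(0,T],\qquad u(\cdot,0)=u_0\ \text{ in }\Omega,\qquad u=g\ \text{ on }\partial\Omega\times(0,T],$$ with $u(\cdot,t)$ regular and with zero gradient on $\partial\Omega$ for every $t\in(0,T]$. Assume that $u(x,\cdot)$ is $C^2$ on $[0,T]$ for every $x\in\Omega$ and that $\partial_t^2u$ is bounded on $\Omega\times[0,T]$. Let $\omega^{\theta}_0=1$ and $\omega^{\theta}_k=\big(1-\frac{\theta+1}{k}\big)\omega^{\theta}_{k-1}$ for $k\ge1$ (so $\omega_k^\theta=\frac{\Gamma(k-\theta)}{\Gamma(-\theta)\Gamma(k+1)}$ for $0<\theta<1$). For an integer $N\ge1$ put $\tau=T/N$ and $t_n=n\tau$. A solution of the semi-discrete scheme (with $q=1$) is a family $U^0,\dots,U^N$ of functions such that $U^0=u_0$ in $\Omega$ and, for $1\le n\le N$, $U^n$ is regular, $U^n=g(\cdot,t_n)$ on $\partial\Omega$, and in $\Omega$ $$\sum_{r=1}^s\frac{a_r\omega_0^{\theta_r}}{\tau^{\theta_r}}U^n-AU^n=f(\cdot,t_n)-\sum_{r=1}^s\frac{a_r}{\tau^{\theta_r}}\sum_{k=1}^{n-1}\omega_k^{\theta_r}U^{n-k}+\sum_{r=1}^s\frac{a_r}{\tau^{\theta_r}}\sum_{k=0}^{n-1}\omega_k^{\theta_r}U^0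 .$$ Then there is a constant $C$, independent of $N$, $n$ and $(U^n)$, such that for every $N\ge1$ and every solution $(U^n)$ of the scheme which satisfies $\partial U^n/\partial x_l=0$ on $\partial\Omega$ for $1\le n\le N$ and every $l$ with $\alpha_l<2$, $$\|u(\cdot,t_n)-U^n\|_{L^2(\Omega)}\le C\tau\qquad(1\le n\le N).$$ -/

import Mathlib

open Set Filter Topology MeasureTheory

noncomputable section

namespace TSFPDE

/-! Points of `ℝ^d` are functions `Fin d → ℝ`; only the topology, the convex structure, the partial
derivatives and Lebesgue measure of this space are used. -/

/-- The norm `‖v‖_{0,Ω} = (∫_Ω v²)^{1/2}`. -/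
def l2Norm {d : ℕ} (Ω : Set (Fin d → ℝ)) (v : (Fin d → ℝ) → ℝ) : ℝ :=
  Real.sqrt (∫ x in Ω, v x ^ 2)

/-! ### Fractional derivatives in space -/

/-- The restriction of `v` to the line through `x` parallel to the `l`-th axis, parametrised by the
`l`-th coordinate. -/
def lineSlice {d : ℕ} (v : (Fin d → ℝ) → ℝ) (x : Fin d → ℝ) (l : Fin d) : ℝ → ℝ :=
  fun ξ => v (Function.update x l ξ)

/-- The smallest `l`-th coordinate in the closure of `Ω` on the line through `x` parallel to the
`l`-th axis. -/
def lowerEnd {d : ℕ} (Ω : Set (Fin d → ℝ)) (x : Fin d → ℝ) (l : Fin d) : ℝ :=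
  sInf {ξ : ℝ | Function.update x l ξ ∈ closure Ω}

/-- The largest `l`-th coordinate in the closure of `Ω` on the line through `x` parallel to the
`l`-th axis. -/
def upperEnd {d : ℕ} (Ω : Set (Fin d → ℝ)) (x : Fin d → ℝ) (l : Fin d) : ℝ :=
  sSup {ξ : ℝ | Function.update x l ξ ∈ closure Ω}

/-- The left-sided space-fractional derivative `∂₊^α v / ∂x_{l,+}^α` of Caputo type, `1 < α ≤ 2`;
for `α = 2` it is the second partial derivative. -/
def spaceDerivLeft {d : ℕ} (Ω : Set (Fin d → ℝ)) (α : ℝ) (l : Fin d)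
    (v : (Fin d → ℝ) → ℝ) (x : Fin d → ℝ) : ℝ :=
  if α = 2 then iteratedDeriv 2 (lineSlice v x l) (x l)
  else 1 / Real.Gamma (2 - α) *
    ∫ ξ in (lowerEnd Ω x l)..(x l), iteratedDeriv 2 (lineSlice v x l) ξ / (x l - ξ) ^ (α - 1)

/-- The right-sided space-fractional derivative `∂₋^α v / ∂x_{l,-}^α` of Caputo type, `1 < α ≤ 2`;
for `α = 2` it is the second partial derivative. -/
def spaceDerivRight {d : ℕ} (Ω : Set (Fin d → ℝ)) (α : ℝ) (l : Fin d)
    (v : (Fin d → ℝ) → ℝ) (x : Fin d → ℝ) : ℝ :=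
  if α = 2 then iteratedDeriv 2 (lineSlice v x l) (x l)
  else 1 / Real.Gamma (2 - α) *
    ∫ ξ in (x l)..(upperEnd Ω x l), iteratedDeriv 2 (lineSlice v x l) ξ / (ξ - x l) ^ (α - 1)

/-- The space operator `∑ₗ εₗ⁺ ∂₊^{αₗ} v + ∑ₗ εₗ⁻ ∂₋^{αₗ} v` with constant coefficients. -/
def spaceOp {d : ℕ} (Ω : Set (Fin d → ℝ)) (α εp εm : Fin d → ℝ)
    (v : (Fin d → ℝ) → ℝ) (x : Fin d → ℝ) : ℝ :=
  (∑ l, εp l * spaceDerivLeft Ω (α l) l v x) + ∑ l, εm l * spaceDerivRight Ω (α l) l v x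

/-- The functions to which the space operator is applied in the classical sense: continuous up to
the boundary, `C²` inside, with second partial derivatives integrable along every chord (they may
be singular at the boundary) and with fractional derivatives in `L²(Ω)`. -/
structure SpaceRegular {d : ℕ} (Ω : Set (Fin d → ℝ)) (α : Fin d → ℝ)
    (v : (Fin d → ℝ) → ℝ) : Prop where
  continuousOn : ContinuousOn v (closure Ω)
  contDiffOn : ContDiffOn ℝ 2 v Ω
  integrableOn_chord : ∀ x ∈ Ω, ∀ l,
    IntegrableOn (iteratedDeriv 2 (lineSlice v x l)) (Ioo (lowerEnd Ω x l) (upperEnd Ω x l))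
  memLp_left : ∀ l, MemLp (spaceDerivLeft Ω (α l) l v) 2 (volume.restrict Ω)
  memLp_right : ∀ l, MemLp (spaceDerivRight Ω (α l) l v) 2 (volume.restrict Ω)

/-- `∂v/∂x_l = 0` on `∂Ω`: the partial derivative inside `Ω` tends to `0` at every boundary
point. -/
def PartialZeroOnBoundary {d : ℕ} (Ω : Set (Fin d → ℝ)) (l : Fin d)
    (v : (Fin d → ℝ) → ℝ) : Prop :=
  ∀ x ∈ frontier Ω, Tendsto (fun y => fderiv ℝ v y (Pi.single l 1)) (𝓝[Ω] x) (𝓝 0)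

/-- `v` has zero gradient on `∂Ω`. -/
def GradZeroOnBoundary {d : ℕ} (Ω : Set (Fin d → ℝ)) (v : (Fin d → ℝ) → ℝ) : Prop :=
  ∀ l, PartialZeroOnBoundary Ω l v

/-! ### Time derivatives -/

/-- The Caputo derivative of order `θ ∈ (0,1]` at time `t ∈ (0,T]` of a function on `[0,T]`. -/
def caputoTime (T θ : ℝ) (w : ℝ → ℝ) (t : ℝ) : ℝ :=
  if θ = 1 then derivWithin w (Icc 0 T) t
  else 1 / Real.Gamma (1 - θ) * ∫ ξ in (0 : ℝ)..t, derivWithin w (Icc 0 T) ξ / (t - ξ) ^ θ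

/-- The multi-term derivative `∑ᵣ aᵣ D^{θᵣ}`. -/
def multiTermCaputo {s : ℕ} (T : ℝ) (a θ : Fin s → ℝ) (w : ℝ → ℝ) (t : ℝ) : ℝ :=
  ∑ r, a r * caputoTime T (θ r) w t

/-- The Grünwald coefficients `ω_k^θ = (-1)^k binom(θ, k)`. -/
def glCoeff (θ : ℝ) : ℕ → ℝ
  | 0 => 1
  | k + 1 => (1 - (θ + 1) / ((k : ℝ) + 1)) * glCoeff θ k

/-- For `0 < θ < 1` the Grünwald coefficients are `Γ(k-θ) / (Γ(-θ) Γ(k+1))`. -/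
theorem glCoeff_eq_Gamma {θ : ℝ} (h0 : 0 < θ) (h1 : θ < 1) (k : ℕ) :
    glCoeff θ k = Real.Gamma (k - θ) / (Real.Gamma (-θ) * Real.Gamma (k + 1)) := by
  have hne : ∀ j : ℕ, (j : ℝ) - θ ≠ 0 := by
    intro j h
    rcases Nat.eq_zero_or_pos j with rfl | hj
    · simp at h
      exact h0.ne' h
    · have : (1 : ℝ) ≤ j := by exact_mod_cast hj
      linarith
  have hG : Real.Gamma (-θ) ≠ 0 := by
    have h := Real.Gamma_add_one (s := -θ) (by linarith : -θ < 0).ne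
    have hp : 0 < Real.Gamma (-θ + 1) := Real.Gamma_pos_of_pos (by linarith)
    intro hz
    rw [hz, mul_zero] at h
    exact hp.ne' h
  induction k with
  | zero => simp [glCoeff, hG]
  | succ k ih =>
    have e1 : ((k + 1 : ℕ) : ℝ) - θ = ((k : ℝ) - θ) + 1 := by push_cast; ring
    have e2 : ((k + 1 : ℕ) : ℝ) + 1 = ((k : ℝ) + 1) + 1 := by push_cast; ring
    have hk : (k : ℝ) + 1 ≠ 0 := by positivity
    have hGk : Real.Gamma ((k : ℝ) + 1) ≠ 0 := (Real.Gamma_pos_of_pos (by positivity)).ne'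
    rw [e1, e2, Real.Gamma_add_one (hne k), Real.Gamma_add_one hk, glCoeff, ih]
    field_simp
    ring

/-! ### The problem and the scheme -/

/-- `u t x` is a classical solution of the initial-boundary value problem
`∑ᵣ aᵣ D_t^{θᵣ} u - ∑ₗ εₗ⁺ ∂₊^{αₗ} u - ∑ₗ εₗ⁻ ∂₋^{αₗ} u = f` in `Ω × (0,T]`,
`u = u₀` at `t = 0`, `u = g` on `∂Ω × (0,T]`. -/
structure IsExactSolution {d s : ℕ} (Ω : Set (Fin d → ℝ)) (T : ℝ) (a θ : Fin s → ℝ)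
    (α εp εm : Fin d → ℝ) (f g : ℝ → (Fin d → ℝ) → ℝ) (u₀ : (Fin d → ℝ) → ℝ)
    (u : ℝ → (Fin d → ℝ) → ℝ) : Prop where
  regular : ∀ t ∈ Ioc 0 T, SpaceRegular Ω α (u t)
  equation : ∀ t ∈ Ioc 0 T, ∀ x ∈ Ω,
    multiTermCaputo T a θ (fun t' => u t' x) t - spaceOp Ω α εp εm (u t) x = f t x
  initial : ∀ x ∈ Ω, u 0 x = u₀ x
  boundary : ∀ t ∈ Ioc 0 T, ∀ x ∈ frontier Ω, u t x = g t x

/-- `U 0, …, U N` is a solution of the semi-discrete scheme (`q = 1`) with `N` time steps of length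
`τ = T / N`, with the initial and boundary data of the problem. -/
structure IsSemiDiscreteSolution {d s : ℕ} (Ω : Set (Fin d → ℝ)) (T : ℝ) (a θ : Fin s → ℝ)
    (α εp εm : Fin d → ℝ) (f g : ℝ → (Fin d → ℝ) → ℝ) (u₀ : (Fin d → ℝ) → ℝ)
    (N : ℕ) (U : ℕ → (Fin d → ℝ) → ℝ) : Prop where
  regular : ∀ n, 1 ≤ n → n ≤ N → SpaceRegular Ω α (U n)
  equation : ∀ n, 1 ≤ n → n ≤ N → ∀ x ∈ Ω,
    (∑ r, a r * glCoeff (θ r) 0 / (T / N) ^ θ r) * U n x - spaceOp Ω α εp εm (U n) x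
      = f (n * (T / N)) x
        - ∑ r, a r / (T / N) ^ θ r * ∑ k ∈ Finset.Ico 1 n, glCoeff (θ r) k * U (n - k) x
        + ∑ r, a r / (T / N) ^ θ r * ∑ k ∈ Finset.range n, glCoeff (θ r) k * U 0 x
  initial : ∀ x ∈ Ω, U 0 x = u₀ x
  boundary : ∀ n, 1 ≤ n → n ≤ N → ∀ x ∈ frontier Ω, U n x = g (n * (T / N)) x

end TSFPDE

end

namespace TSFPDE

/-! ### One-dimensional energy inequalities -/

/-! The errors `e n = u(t_n) - U n` satisfy the scheme itself, with zero initial and boundary values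
and with the truncation error of the Grünwald formula as right-hand side. Testing this equation with
`e n` gives the estimate, from one fact about space and one about time.

Space: `(A v, v) ≤ 0` if `v` vanishes on `∂Ω` and so does `∂v/∂x_l` whenever `α l < 2`
(`integral_mul_spaceOp_nonpos`). By Fubini it suffices to look at one chord `(L, R)`. There the
kernel `r ^ (-γ)`, `γ = α - 1`, is a positive superposition of the kernels `exp (-λ r)`, by Euler's
integral for `Γ(γ)`. For an exponential kernel the convolution with `v''` is `W'`, where `W' + λ W =
v'` and `W(L) = 0`, so that the pairing with `v` is `-W(R)²/2 - λ ∫ W²`. The vanishing derivative at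
the end of the chord is what makes the Caputo form equal to `W'`.

Time: the truncation error is not uniformly `O(τ)`; besides `O(τ)` it contains a part of size `τ t_n
^ (-θ)` coming from the initial velocity. It is therefore measured against a barrier. With `b_j` the
partial sums of the Grünwald coefficients, the discrete operator, without subtraction of the initial
value, maps `1 + t` to `τ ^ (-θ) (b_{n-1} + τ ∑_{j<n} b_j)`, and `abs_gl_sub_caputo_le` bounds the
truncation error by a constant times `τ` times this. The proof compares `b_j` with the weights of
piecewise linear interpolation: their cumulative difference is at most the last `b_j`, by
log-convexity of `Γ`, and summation by parts moves the differences onto `w`.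

Since `ω_k ≤ 0` for `k ≥ 1`, the energy inequality is a discrete convolution inequality for the
norms of the errors, and `discrete_comparison` bounds them by `|Ω|^{1/2} K τ (1 + t_n)`. -/

theorem integral_mul_exp_convolution_nonpos {L R lam : ℝ} (hLR : L ≤ R) (hlam : 0 ≤ lam)
    {v w h : ℝ → ℝ} (hv : ContinuousOn v (Icc L R)) (hw : Continuous w)
    (hvw : ∀ x ∈ Ioo L R, HasDerivAt v (w x) x) (hwh : ∀ x ∈ Ioo L R, HasDerivAt w (h x) x)
    (hh : IntervalIntegrable h volume L R) (hvL : v L = 0) (hvR : v R = 0) (hwL : w L = 0) :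
    ∫ x in L..R, v x * ∫ y in L..x, Real.exp (-(lam * (x - y))) * h y ≤ 0 := by
  set q : ℝ → ℝ := fun x => ∫ y in L..x, Real.exp (lam * y) * w y with hq
  have hcont : Continuous fun y => Real.exp (lam * y) * w y := by fun_prop
  have hqd : ∀ x, HasDerivAt q (Real.exp (lam * x) * w x) x := fun x =>
    (hcont.integral_hasStrictDerivAt L x).hasDerivAt
  -- `W` solves `W' + λ W = w` with `W L = 0`. Integration by parts, with `w L = 0`, turns the
  -- convolution of `h = w'` into `w - λ W = W'`.
  set W : ℝ → ℝ := fun x => Real.exp (-(lam * x)) * q x with hW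
  have hWd : ∀ x, HasDerivAt W (w x - lam * W x) x := by
    intro x
    have h1 : HasDerivAt (fun x : ℝ => Real.exp (-(lam * x))) (Real.exp (-(lam * x)) * (-lam)) x := by
      have := (((hasDerivAt_id x).const_mul lam).neg).exp
      simpa using this
    have h2 := h1.mul (hqd x)
    refine h2.congr_deriv ?_
    have : Real.exp (-(lam * x)) * Real.exp (lam * x) = 1 := by
      rw [← Real.exp_add]; simp
    simp only [hW]
    linear_combination w x * this
  have hWc : Continuous W := continuous_iff_continuousAt.2 fun x => (hWd x).continuousAt
  have hWL : W L = 0 := by simp [hW, hq]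
  have key : ∀ x ∈ Icc L R,
      ∫ y in L..x, Real.exp (-(lam * (x - y))) * h y = w x - lam * W x := by
    intro x hx
    have hhx : IntervalIntegrable h volume L x :=
      hh.mono_set (by rw [uIcc_of_le hx.1, uIcc_of_le hLR]; exact Icc_subset_Icc_right hx.2)
    have i1 : IntervalIntegrable (fun y => Real.exp (lam * y) * h y) volume L x :=
      hhx.continuousOn_mul (by fun_prop)
    have i2 : IntervalIntegrable (fun y => Real.exp (lam * y) * w y) volume L x :=
      hcont.intervalIntegrable _ _
    have ftc : ∫ y in L..x, (Real.exp (lam * y) * h y + lam * (Real.exp (lam * y) * w y))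
        = Real.exp (lam * x) * w x - Real.exp (lam * L) * w L := by
      refine intervalIntegral.integral_eq_sub_of_hasDerivAt_of_le
        (f := fun y => Real.exp (lam * y) * w y) hx.1 hcont.continuousOn ?_
        (i1.add (i2.const_mul lam))
      intro y hy
      have h1 : HasDerivAt (fun y : ℝ => Real.exp (lam * y)) (Real.exp (lam * y) * lam) y := by
        have := ((hasDerivAt_id y).const_mul lam).exp
        simpa using this
      exact (h1.mul (hwh y ⟨hy.1, hy.2.trans_le hx.2⟩)).congr_deriv (by ring)
    rw [intervalIntegral.integral_add i1 (i2.const_mul lam), intervalIntegral.integral_const_mul,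
      hwL, mul_zero, sub_zero] at ftc
    have e : ∀ y, Real.exp (-(lam * (x - y))) * h y
        = Real.exp (-(lam * x)) * (Real.exp (lam * y) * h y) := by
      intro y
      rw [← mul_assoc, ← Real.exp_add]; congr 2; ring
    simp_rw [e]
    rw [intervalIntegral.integral_const_mul]
    have : Real.exp (-(lam * x)) * Real.exp (lam * x) = 1 := by
      rw [← Real.exp_add]; simp
    have ftc' : ∫ y in L..x, Real.exp (lam * y) * h y = Real.exp (lam * x) * w x - lam * q x := by
      simp only [hq]; linarith
    rw [ftc']
    simp only [hW]
    linear_combination w x * this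
  have e1 : ∫ x in L..R, v x * ∫ y in L..x, Real.exp (-(lam * (x - y))) * h y
      = ∫ x in L..R, v x * (w x - lam * W x) := by
    refine intervalIntegral.integral_congr fun x hx => ?_
    rw [uIcc_of_le hLR] at hx
    simp only [key x hx]
  have hvI : IntervalIntegrable (fun x => v x * (w x - lam * W x)) volume L R := by
    refine ContinuousOn.intervalIntegrable ?_
    rw [uIcc_of_le hLR]
    exact hv.mul (by fun_prop)
  have hWI : IntervalIntegrable (fun x => lam * W x ^ 2) volume L R :=
    Continuous.intervalIntegrable (by fun_prop) _ _
  -- The integrand is the derivative of `v W - W² / 2`, because `v' = w = W' + λ W`. Only `-W(R)² /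
  -- 2` survives at the ends.
  have e2 : ∫ x in L..R, (v x * (w x - lam * W x) + lam * W x ^ 2)
      = (v R * W R - W R ^ 2 / 2) - (v L * W L - W L ^ 2 / 2) * 1 := by
    rw [mul_one]
    refine intervalIntegral.integral_eq_sub_of_hasDerivAt_of_le
      (f := fun x => v x * W x - W x ^ 2 / 2) hLR ?_ ?_ (hvI.add hWI)
    · exact (hv.mul hWc.continuousOn).sub (by fun_prop)
    · intro x hx
      exact (((hvw x hx).mul (hWd x)).sub (((hWd x).pow 2).div_const 2)).congr_deriv
        (by push_cast; ring)
  rw [intervalIntegral.integral_add hvI hWI, hvR, hvL, hWL] at e2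
  have e3 : 0 ≤ ∫ x in L..R, lam * W x ^ 2 :=
    intervalIntegral.integral_nonneg hLR fun x _ => by positivity
  rw [e1]
  nlinarith [sq_nonneg (W R)]

/-- Integrability of `v(x) h(y) (x-y)₊^{-γ}`. -/
theorem integrable_mul_rpow_kernel {L R γ : ℝ} (hγ1 : γ < 1)
    {v h : ℝ → ℝ} {B : ℝ} (hv : AEStronglyMeasurable v volume) (hvB : ∀ x, |v x| ≤ B)
    (hvs : ∀ x, x ∉ Ioo L R → v x = 0) (hh : Integrable h) (hhs : ∀ x, x ∉ Ioo L R → h x = 0) :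
    Integrable (fun p : ℝ × ℝ => v p.1 * h p.2 * (Ioi 0).indicator (fun s => s ^ (-γ)) (p.1 - p.2))
      (volume.prod volume) := by
  -- The power kernel is integrable only after truncation at `R - L`. On the supports of `v` and `h`
  -- the difference `p.1 - p.2` stays below `R - L`, so the truncation changes nothing.
  have hk : Integrable ((Ioo 0 (R - L)).indicator fun s : ℝ => s ^ (-γ)) := by
    rw [integrable_indicator_iff measurableSet_Ioo]
    rcases le_total (R - L) 0 with h0 | h0
    · simp [Ioo_eq_empty_of_le h0]
    · exact ((intervalIntegrable_iff_integrableOn_Ioc_of_le h0).1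
        (intervalIntegral.intervalIntegrable_rpow' (by linarith))).mono_set Ioo_subset_Ioc_self
  have hc := Integrable.convolution_integrand (ContinuousLinearMap.mul ℝ ℝ) hh hk
  have hc2 : Integrable (fun p : ℝ × ℝ => v p.1 * (h p.2 *
      (Ioo 0 (R - L)).indicator (fun s : ℝ => s ^ (-γ)) (p.1 - p.2))) (volume.prod volume) := by
    refine hc.bdd_mul (c := B) ?_ ?_
    · exact hv.comp_fst
    · exact Eventually.of_forall fun p => hvB p.1
  refine hc2.congr (Eventually.of_forall fun p => ?_)
  simp only
  rw [mul_assoc]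
  by_cases h1 : p.1 ∈ Ioo L R
  · by_cases h2 : p.2 ∈ Ioo L R
    · congr 2
      by_cases h3 : p.1 - p.2 ∈ Ioi (0 : ℝ)
      · have : p.1 - p.2 ∈ Ioo 0 (R - L) := ⟨h3, by linarith [h1.2, h2.1]⟩
        rw [indicator_of_mem h3, indicator_of_mem this]
      · have : p.1 - p.2 ∉ Ioo 0 (R - L) := fun h => h3 h.1
        rw [indicator_of_notMem h3, indicator_of_notMem this]
    · simp [hhs _ h2]
  · simp [hvs _ h1]

theorem integral_rpow_mul_exp_indicator {γ : ℝ} (hγ0 : 0 < γ) (s : ℝ) :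
    ∫ lam in Ioi (0 : ℝ), (Ioi 0).indicator (fun s => lam ^ (γ - 1) * Real.exp (-(lam * s))) s
      = Real.Gamma γ * (Ioi 0).indicator (fun s => s ^ (-γ)) s := by
  by_cases hs : s ∈ Ioi (0 : ℝ)
  · simp only [indicator_of_mem hs]
    have := Real.integral_rpow_mul_exp_neg_mul_Ioi hγ0 hs
    simp_rw [mul_comm _ s, this]
    rw [one_div, Real.inv_rpow (le_of_lt hs), ← Real.rpow_neg (le_of_lt hs), mul_comm]
  · simp [indicator_of_notMem hs]

/-- By Euler's integral, `Γ(γ)` times the left-hand side is the integral over `λ > 0` of `λ ^ (γ -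
1)` times the same form with kernel `exp (-λ (x - y))`. Fubini applies, and each exponential form is
nonpositive. -/
theorem integral_mul_rpow_convolution_nonpos {L R γ : ℝ} (hLR : L ≤ R) (hγ0 : 0 < γ) (hγ1 : γ < 1)
    {v w h : ℝ → ℝ} (hv : ContinuousOn v (Icc L R)) (hw : Continuous w)
    (hvw : ∀ x ∈ Ioo L R, HasDerivAt v (w x) x) (hwh : ∀ x ∈ Ioo L R, HasDerivAt w (h x) x)
    (hh : IntegrableOn h (Ioo L R)) (hvL : v L = 0) (hvR : v R = 0) (hwL : w L = 0) :
    ∫ x in Ioo L R, v x * ∫ y in L..x, h y / (x - y) ^ γ ≤ 0 := by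
  set v' := (Ioo L R).indicator v with hv'
  set h' := (Ioo L R).indicator h with hh'
  have hh'i : Integrable h' := (integrable_indicator_iff measurableSet_Ioo).2 hh
  obtain ⟨B, hB⟩ := isCompact_Icc.exists_bound_of_continuousOn hv
  have hvm : AEStronglyMeasurable v' volume :=
    (aestronglyMeasurable_indicator_iff measurableSet_Ioo).2
      ((hv.mono Ioo_subset_Icc_self).aestronglyMeasurable measurableSet_Ioo)
  have hB' : ∀ x, |v' x| ≤ max B 0 := by
    intro x
    by_cases hx : x ∈ Ioo L R
    · rw [hv', indicator_of_mem hx]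
      exact (hB x (Ioo_subset_Icc_self hx)).trans (le_max_left _ _)
    · rw [hv', indicator_of_notMem hx]; simp
  have hvs : ∀ x, x ∉ Ioo L R → v' x = 0 := fun x hx => indicator_of_notMem hx _
  have hhs : ∀ x, x ∉ Ioo L R → h' x = 0 := fun x hx => indicator_of_notMem hx _
  have hK := integrable_mul_rpow_kernel hγ1 hvm hB' hvs hh'i hhs
  set E : ℝ × ℝ → ℝ → ℝ := fun p lam =>
    (Ioi 0).indicator (fun s => lam ^ (γ - 1) * Real.exp (-(lam * s))) (p.1 - p.2) with hE
  have hEm : Measurable (Function.uncurry E) := by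
    have : Function.uncurry E = {z : (ℝ × ℝ) × ℝ | 0 < z.1.1 - z.1.2}.indicator
        (fun z => z.2 ^ (γ - 1) * Real.exp (-(z.2 * (z.1.1 - z.1.2)))) := by
      ext z
      simp only [Function.uncurry, hE, indicator, mem_Ioi, mem_ofPred_eq]
    rw [this]
    refine Measurable.indicator (by fun_prop) (measurableSet_lt (by fun_prop) (by fun_prop))
  have hE0 : ∀ p, ∀ lam ∈ Ioi (0 : ℝ), 0 ≤ E p lam := by
    intro p lam hl
    refine indicator_nonneg (fun s _ => ?_) _
    have : (0 : ℝ) ≤ lam ^ (γ - 1) := Real.rpow_nonneg (le_of_lt hl) _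
    positivity
  have hEi : ∀ p, IntegrableOn (E p) (Ioi 0) := by
    intro p
    by_cases hs : p.1 - p.2 ∈ Ioi (0 : ℝ)
    · simp only [hE, indicator_of_mem hs]
      -- A non-integrable function would have integral `0`, whereas Euler's formula gives a positive
      -- value.
      by_contra hcon
      have := Real.integral_rpow_mul_exp_neg_mul_Ioi hγ0 hs
      simp_rw [mul_comm (p.1 - p.2)] at this
      rw [integral_undef hcon] at this
      have h1 : 0 < (1 / (p.1 - p.2)) ^ γ * Real.Gamma γ :=
        mul_pos (Real.rpow_pos_of_pos (one_div_pos.2 hs) _) (Real.Gamma_pos_of_pos hγ0)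
      linarith
    · simp only [hE, indicator_of_notMem hs]; exact integrableOn_zero
  have hEint : ∀ p : ℝ × ℝ, ∫ lam in Ioi (0 : ℝ), E p lam
      = Real.Gamma γ * (Ioi 0).indicator (fun s => s ^ (-γ)) (p.1 - p.2) := fun p =>
    integral_rpow_mul_exp_indicator hγ0 _
  have hA : AEStronglyMeasurable (fun p : ℝ × ℝ => v' p.1 * h' p.2) (volume.prod volume) :=
    hvm.comp_fst.mul hh'i.aestronglyMeasurable.comp_snd
  -- The `λ`-integral of the absolute value is evaluated first. It returns the power kernel up to
  -- the factor `Γ(γ)`, so the claim reduces to `hK`.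
  have hG : Integrable (fun z : (ℝ × ℝ) × ℝ => v' z.1.1 * h' z.1.2 * E z.1 z.2)
      ((volume.prod volume).prod (volume.restrict (Ioi 0))) := by
    have hm : AEStronglyMeasurable (fun z : (ℝ × ℝ) × ℝ => v' z.1.1 * h' z.1.2 * E z.1 z.2)
        ((volume.prod volume).prod (volume.restrict (Ioi 0))) :=
      hA.comp_fst.mul hEm.aestronglyMeasurable
    rw [integrable_prod_iff hm]
    refine ⟨Eventually.of_forall fun p => (hEi p).const_mul (v' p.1 * h' p.2), ?_⟩
    refine (hK.norm.const_mul (Real.Gamma γ)).congr (Eventually.of_forall fun p => ?_)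
    have : ∫ lam in Ioi (0 : ℝ), ‖v' p.1 * h' p.2 * E p lam‖
        = ∫ lam in Ioi (0 : ℝ), ‖v' p.1 * h' p.2‖ * E p lam :=
      setIntegral_congr_fun measurableSet_Ioi fun lam hl => by
        simp only [norm_mul, Real.norm_of_nonneg (hE0 p lam hl)]
    simp only [this]
    rw [integral_const_mul, hEint, norm_mul,
      Real.norm_of_nonneg (r := (Ioi 0).indicator _ _)
        (indicator_nonneg (fun s hs => Real.rpow_nonneg (le_of_lt hs) _) _)]
    ring
  have hswap := integral_integral_swap (f := fun (p : ℝ × ℝ) lam => v' p.1 * h' p.2 * E p lam) hG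
  have hleft : ∫ p : ℝ × ℝ, ∫ lam in Ioi (0 : ℝ), v' p.1 * h' p.2 * E p lam
      ∂volume ∂(volume.prod volume) =
      Real.Gamma γ * ∫ x in Ioo L R, v x * ∫ y in L..x, h y / (x - y) ^ γ := by
    have e1 : ∀ p : ℝ × ℝ, ∫ lam in Ioi (0 : ℝ), v' p.1 * h' p.2 * E p lam
        = Real.Gamma γ * (v' p.1 * h' p.2 * (Ioi 0).indicator (fun s => s ^ (-γ)) (p.1 - p.2)) := by
      intro p
      rw [integral_const_mul, hEint]; ring
    simp_rw [e1]
    rw [integral_const_mul, integral_prod _ hK, ← integral_indicator measurableSet_Ioo]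
    congr 2 with x
    by_cases hx : x ∈ Ioo L R
    · rw [indicator_of_mem hx]
      simp only [mul_assoc]
      rw [integral_const_mul, hv', indicator_of_mem hx,
        intervalIntegral.integral_of_le hx.1.le, integral_Ioc_eq_integral_Ioo,
        ← integral_indicator measurableSet_Ioo]
      congr 2 with y
      by_cases hy : y ∈ Ioo L x
      · have hy' : y ∈ Ioo L R := ⟨hy.1, hy.2.trans hx.2⟩
        have hs : x - y ∈ Ioi (0 : ℝ) := sub_pos.2 hy.2
        rw [indicator_of_mem hy, hh', indicator_of_mem hy', indicator_of_mem hs,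
          Real.rpow_neg (le_of_lt hs), div_eq_mul_inv]
      · rw [indicator_of_notMem hy]
        by_cases hyL : L < y
        · have hs : x - y ∉ Ioi (0 : ℝ) := by
            intro h; exact hy ⟨hyL, sub_pos.1 h⟩
          rw [indicator_of_notMem hs, mul_zero]
        · rw [hhs y fun h => hyL h.1, zero_mul]
    · rw [indicator_of_notMem hx]
      simp [hvs x hx]
  have hright : ∫ lam in Ioi (0 : ℝ), ∫ p : ℝ × ℝ, v' p.1 * h' p.2 * E p lam
      ∂(volume.prod volume) ≤ 0 := by
    refine integral_nonpos_of_ae ?_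
    have hae := hG.prod_left_ae
    filter_upwards [hae, ae_restrict_mem measurableSet_Ioi] with lam hi hl
    have hl' : (0 : ℝ) < lam := hl
    simp only [Pi.zero_apply]
    rw [integral_prod _ hi]
    have e : ∀ x, ∫ y, v' x * h' y * E (x, y) lam
        = (Ioo L R).indicator (fun x => lam ^ (γ - 1) *
          (v x * ∫ y in L..x, Real.exp (-(lam * (x - y))) * h y)) x := by
      intro x
      by_cases hx : x ∈ Ioo L R
      · rw [indicator_of_mem hx]
        simp only [mul_assoc]
        rw [integral_const_mul, hv', indicator_of_mem hx,
          intervalIntegral.integral_of_le hx.1.le, integral_Ioc_eq_integral_Ioo,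
          ← integral_indicator measurableSet_Ioo, mul_left_comm,
          ← integral_const_mul (lam ^ (γ - 1))]
        congr 2 with y
        by_cases hy : y ∈ Ioo L x
        · have hy' : y ∈ Ioo L R := ⟨hy.1, hy.2.trans hx.2⟩
          have hs : x - y ∈ Ioi (0 : ℝ) := sub_pos.2 hy.2
          simp only [hE]
          rw [indicator_of_mem hy, hh', indicator_of_mem hy', indicator_of_mem hs]
          ring
        · rw [indicator_of_notMem hy]
          by_cases hyL : L < y
          · have hs : x - y ∉ Ioi (0 : ℝ) := by
              intro h; exact hy ⟨hyL, sub_pos.1 h⟩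
            simp only [hE]
            rw [indicator_of_notMem hs, mul_zero, mul_zero]
          · rw [hhs y fun h => hyL h.1, zero_mul, mul_zero]
      · rw [indicator_of_notMem hx]
        simp [hvs x hx]
    simp_rw [e]
    rw [integral_indicator measurableSet_Ioo, integral_const_mul, ← integral_Ioc_eq_integral_Ioo,
      ← intervalIntegral.integral_of_le hLR]
    refine mul_nonpos_of_nonneg_of_nonpos (Real.rpow_nonneg hl'.le _) ?_
    exact integral_mul_exp_convolution_nonpos hLR hl'.le hv hw hvw hwh
      ((intervalIntegrable_iff_integrableOn_Ioo_of_le hLR).2 hh) hvL hvR hwL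
  rw [hleft] at hswap
  rw [← hswap] at hright
  exact nonpos_of_mul_nonpos_right hright (Real.Gamma_pos_of_pos hγ0)

/-- The reflection `x ↦ -x` exchanges the two one-sided kernels. The derivative must now vanish at
`R`, the end at which the reflected convolution starts. -/
theorem integral_mul_rpow_convolution_right_nonpos {L R γ : ℝ} (hLR : L ≤ R) (hγ0 : 0 < γ)
    (hγ1 : γ < 1) {v w h : ℝ → ℝ} (hv : ContinuousOn v (Icc L R)) (hw : Continuous w)
    (hvw : ∀ x ∈ Ioo L R, HasDerivAt v (w x) x) (hwh : ∀ x ∈ Ioo L R, HasDerivAt w (h x) x)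
    (hh : IntegrableOn h (Ioo L R)) (hvL : v L = 0) (hvR : v R = 0) (hwR : w R = 0) :
    ∫ x in Ioo L R, v x * ∫ y in x..R, h y / (y - x) ^ γ ≤ 0 := by
  have hmem : ∀ x ∈ Ioo (-R) (-L), -x ∈ Ioo L R := fun x hx =>
    ⟨by linarith [hx.2], by linarith [hx.1]⟩
  have key := integral_mul_rpow_convolution_nonpos (L := -R) (R := -L) (by linarith) hγ0 hγ1
    (v := fun x => v (-x)) (w := fun x => -w (-x)) (h := fun x => h (-x))
    (hv.comp continuousOn_neg fun x hx => ⟨by linarith [hx.2], by linarith [hx.1]⟩)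
    (by fun_prop)
    (fun x hx => by
      exact ((hvw (-x) (hmem x hx)).scomp x (hasDerivAt_neg x)).congr_deriv (by simp))
    (fun x hx => by
      exact ((hwh (-x) (hmem x hx)).scomp x (hasDerivAt_neg x)).neg.congr_deriv (by simp))
    (by
      rw [← intervalIntegrable_iff_integrableOn_Ioo_of_le (by linarith)]
      have : IntervalIntegrable h volume L R :=
        (intervalIntegrable_iff_integrableOn_Ioo_of_le hLR).2 hh
      exact ((IntervalIntegrable.iff_comp_neg (by finiteness)).1 this).symm)
    (by simpa using hvR) (by simpa using hvL) (by simpa using hwR)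
  have e : ∀ x, ∫ y in (-R)..x, h (-y) / (x - y) ^ γ = ∫ y in (-x)..R, h y / (y - -x) ^ γ := by
    intro x
    have := intervalIntegral.integral_comp_neg (a := -R) (b := x)
      (fun y => h y / (y - -x) ^ γ)
    simp only [neg_neg] at this
    rw [← this]
    congr 2 with y
    ring_nf
  simp_rw [e] at key
  rw [← integral_Ioc_eq_integral_Ioo, ← intervalIntegral.integral_of_le (by linarith),
    intervalIntegral.integral_comp_neg (fun x => v x * ∫ y in x..R, h y / (y - x) ^ γ),
    neg_neg, neg_neg, intervalIntegral.integral_of_le hLR, integral_Ioc_eq_integral_Ioo] at key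
  exact key

/-- Integration by parts leaves `-∫ w²`. The boundary term vanishes through `v` alone, so the order
`α = 2` needs no condition on the derivative at the ends. -/
theorem integral_mul_second_deriv_nonpos {L R : ℝ} (hLR : L ≤ R)
    {v w h : ℝ → ℝ} (hv : ContinuousOn v (Icc L R)) (hw : Continuous w)
    (hvw : ∀ x ∈ Ioo L R, HasDerivAt v (w x) x) (hwh : ∀ x ∈ Ioo L R, HasDerivAt w (h x) x)
    (hh : IntegrableOn h (Ioo L R)) (hvL : v L = 0) (hvR : v R = 0) :
    ∫ x in Ioo L R, v x * h x ≤ 0 := by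
  rw [← integral_Ioc_eq_integral_Ioo, ← intervalIntegral.integral_of_le hLR]
  have hhI := (intervalIntegrable_iff_integrableOn_Ioo_of_le hLR).2 hh
  have i1 : IntervalIntegrable (fun x => v x * h x) volume L R :=
    hhI.continuousOn_mul (by rwa [uIcc_of_le hLR])
  have i2 : IntervalIntegrable (fun x => w x ^ 2) volume L R :=
    Continuous.intervalIntegrable (by fun_prop) _ _
  have ftc : ∫ x in L..R, (v x * h x + w x ^ 2) = v R * w R - v L * w L :=
    intervalIntegral.integral_eq_sub_of_hasDerivAt_of_le (f := fun x => v x * w x) hLR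
      (hv.mul hw.continuousOn)
      (fun x hx => ((hvw x hx).mul (hwh x hx)).congr_deriv (by ring)) (i1.add i2)
  rw [intervalIntegral.integral_add i1 i2, hvL, hvR] at ftc
  have : 0 ≤ ∫ x in L..R, w x ^ 2 := intervalIntegral.integral_nonneg hLR fun x _ => by positivity
  linarith

/-- A `C²` function on an open interval with integrable second derivative has a first derivative
which extends continuously. -/
theorem exists_continuous_extension_deriv {L R : ℝ} {φ : ℝ → ℝ} (hLR : L < R)
    (hφ : ContDiffOn ℝ 2 φ (Ioo L R)) (hint : IntegrableOn (iteratedDeriv 2 φ) (Ioo L R)) :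
    ∃ w : ℝ → ℝ, Continuous w ∧ (∀ x ∈ Ioo L R, w x = deriv φ x) ∧
      (∀ x ∈ Ioo L R, HasDerivAt φ (w x) x) ∧
      ∀ x ∈ Ioo L R, HasDerivAt w (iteratedDeriv 2 φ x) x := by
  have h2 : ContDiffOn ℝ (1 + 1) φ (Ioo L R) := by rwa [one_add_one_eq_two]
  obtain ⟨hd, -, hφ'⟩ := (contDiffOn_succ_iff_deriv_of_isOpen isOpen_Ioo).1 h2
  have hd1 : ∀ x ∈ Ioo L R, HasDerivAt φ (deriv φ x) x := fun x hx =>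
    ((hd x hx).differentiableAt (isOpen_Ioo.mem_nhds hx)).hasDerivAt
  have hd2 : ∀ x ∈ Ioo L R, HasDerivAt (deriv φ) (iteratedDeriv 2 φ x) x := fun x hx => by
    have := ((hφ'.differentiableOn one_ne_zero x hx).differentiableAt
      (isOpen_Ioo.mem_nhds hx)).hasDerivAt
    rwa [iteratedDeriv_succ, iteratedDeriv_one]
  set h := (Ioo L R).indicator (iteratedDeriv 2 φ) with hh
  have hi : Integrable h := (integrable_indicator_iff measurableSet_Ioo).2 hint
  set c := (L + R) / 2 with hc
  have hcm : c ∈ Ioo L R := ⟨by rw [hc]; linarith, by rw [hc]; linarith⟩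
  -- The primitive starts at the midpoint, where the derivative is known to exist. Extending the
  -- second derivative by zero makes the primitive continuous on the whole line, including the ends.
  set w : ℝ → ℝ := fun x => deriv φ c + ∫ y in c..x, h y with hw
  have hwc : Continuous w := continuous_const.add
    (intervalIntegral.continuous_primitive (fun a b => hi.intervalIntegrable) c)
  have hwe : ∀ x ∈ Ioo L R, w x = deriv φ x := by
    intro x hx
    have hsub : uIcc c x ⊆ Ioo L R := (ordConnected_Ioo).uIcc_subset hcm hx
    have := intervalIntegral.integral_eq_sub_of_hasDerivAt (a := c) (b := x) (f := deriv φ) (f' := h)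
      (fun y hy => by
        rw [hh, indicator_of_mem (hsub hy)]
        exact hd2 y (hsub hy)) hi.intervalIntegrable
    simp only [hw, this]; ring
  refine ⟨w, hwc, hwe, fun x hx => by rw [hwe x hx]; exact hd1 x hx, fun x hx => ?_⟩
  refine (hd2 x hx).congr_of_eventuallyEq ?_
  filter_upwards [isOpen_Ioo.mem_nhds hx] with y hy using hwe y hy

/-! ### Chords of a convex set -/

section Chords

variable {d : ℕ} {Ω : Set (Fin d → ℝ)}

theorem lineSlice_update (v : (Fin d → ℝ) → ℝ) (x : Fin d → ℝ) (l : Fin d) (ξ : ℝ) :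
    lineSlice v (Function.update x l ξ) l = lineSlice v x l := by
  funext η; simp [lineSlice]

theorem lowerEnd_update (x : Fin d → ℝ) (l : Fin d) (ξ : ℝ) :
    lowerEnd Ω (Function.update x l ξ) l = lowerEnd Ω x l := by
  simp [lowerEnd]

theorem upperEnd_update (x : Fin d → ℝ) (l : Fin d) (ξ : ℝ) :
    upperEnd Ω (Function.update x l ξ) l = upperEnd Ω x l := by
  simp [upperEnd]

theorem continuous_update_coord (x : Fin d → ℝ) (l : Fin d) :
    Continuous fun ξ : ℝ => Function.update x l ξ :=
  continuous_const.update l continuous_id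

theorem isCompact_chord_closure (hb : Bornology.IsBounded Ω) (x : Fin d → ℝ) (l : Fin d) :
    IsCompact {ξ : ℝ | Function.update x l ξ ∈ closure Ω} := by
  refine Metric.isCompact_of_isClosed_isBounded
    (isClosed_closure.preimage (continuous_update_coord x l)) ?_
  obtain ⟨C, hC⟩ := hb.closure.exists_norm_le
  refine isBounded_iff_forall_norm_le.2 ⟨C, fun ξ hξ => ?_⟩
  have := (norm_le_pi_norm (Function.update x l ξ) l).trans (hC _ hξ)
  simpa using this

theorem mem_openSegment_update {x : Fin d → ℝ} {l : Fin d} {a b c : ℝ}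
    (h : c ∈ openSegment ℝ a b) :
    Function.update x l c ∈ openSegment ℝ (Function.update x l a) (Function.update x l b) := by
  obtain ⟨p, q, hp, hq, hpq, rfl⟩ := h
  refine ⟨p, q, hp, hq, hpq, ?_⟩
  ext j
  by_cases hj : j = l
  · subst hj; simp
  · simp only [Pi.add_apply, Pi.smul_apply, Function.update_of_ne hj, smul_eq_mul]
    rw [← add_mul, hpq, one_mul]

theorem lowerEnd_mem_closure (hb : Bornology.IsBounded Ω) {x : Fin d → ℝ} (hx : x ∈ Ω)
    (l : Fin d) : Function.update x l (lowerEnd Ω x l) ∈ closure Ω :=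
  (isCompact_chord_closure hb x l).sInf_mem ⟨x l, by simpa using subset_closure hx⟩

theorem upperEnd_mem_closure (hb : Bornology.IsBounded Ω) {x : Fin d → ℝ} (hx : x ∈ Ω)
    (l : Fin d) : Function.update x l (upperEnd Ω x l) ∈ closure Ω :=
  (isCompact_chord_closure hb x l).sSup_mem ⟨x l, by simpa using subset_closure hx⟩

/-- Openness gives the strict inequalities. Conversely, the open segment from a point of the closure
to the interior point `x` lies in the interior, and every `ξ` in the interval other than `x l` is on
such a segment towards one of the two ends. -/
theorem update_mem_iff_mem_Ioo (ho : IsOpen Ω) (hc : Convex ℝ Ω) (hb : Bornology.IsBounded Ω)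
    {x : Fin d → ℝ} (hx : x ∈ Ω) (l : Fin d) (ξ : ℝ) :
    Function.update x l ξ ∈ Ω ↔ ξ ∈ Ioo (lowerEnd Ω x l) (upperEnd Ω x l) := by
  have hK := isCompact_chord_closure hb x l
  have hseg : ∀ a c : ℝ, Function.update x l a ∈ closure Ω → c ∈ openSegment ℝ a (x l) →
      Function.update x l c ∈ Ω := by
    intro a c ha hcm
    have h1 := mem_openSegment_update (x := x) (l := l) hcm
    rw [Function.update_eq_self] at h1
    have := hc.openSegment_closure_interior_subset_interior ha (by rwa [ho.interior_eq]) h1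
    rwa [ho.interior_eq] at this
  constructor
  · intro h
    have hnhds : {η : ℝ | Function.update x l η ∈ Ω} ∈ 𝓝 ξ :=
      (ho.preimage (continuous_update_coord x l)).mem_nhds h
    obtain ⟨ε, hε, hball⟩ := Metric.mem_nhds_iff.1 hnhds
    have m1 : Function.update x l (ξ - ε / 2) ∈ closure Ω := subset_closure <| hball <| by
      rw [Metric.mem_ball, Real.dist_eq, abs_lt]; constructor <;> linarith
    have m2 : Function.update x l (ξ + ε / 2) ∈ closure Ω := subset_closure <| hball <| by
      rw [Metric.mem_ball, Real.dist_eq, abs_lt]; constructor <;> linarith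
    have l1 : lowerEnd Ω x l ≤ ξ - ε / 2 := csInf_le hK.bddBelow m1
    have l2 : ξ + ε / 2 ≤ upperEnd Ω x l := le_csSup hK.bddAbove m2
    exact ⟨by linarith, by linarith⟩
  · rintro ⟨h1, h2⟩
    rcases lt_trichotomy ξ (x l) with h | h | h
    · refine hseg _ _ (lowerEnd_mem_closure hb hx l) ?_
      rw [openSegment_eq_Ioo (h1.trans h)]; exact ⟨h1, h⟩
    · rw [h, Function.update_eq_self]; exact hx
    · refine hseg _ _ (upperEnd_mem_closure hb hx l) ?_
      rw [openSegment_symm, openSegment_eq_Ioo (h.trans h2)]; exact ⟨h, h2⟩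

theorem coord_mem_Ioo (ho : IsOpen Ω) (hc : Convex ℝ Ω) (hb : Bornology.IsBounded Ω)
    {x : Fin d → ℝ} (hx : x ∈ Ω) (l : Fin d) :
    x l ∈ Ioo (lowerEnd Ω x l) (upperEnd Ω x l) :=
  (update_mem_iff_mem_Ioo ho hc hb hx l (x l)).1 (by simpa using hx)

theorem lowerEnd_mem_frontier (ho : IsOpen Ω) (hc : Convex ℝ Ω) (hb : Bornology.IsBounded Ω)
    {x : Fin d → ℝ} (hx : x ∈ Ω) (l : Fin d) :
    Function.update x l (lowerEnd Ω x l) ∈ frontier Ω := by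
  rw [ho.frontier_eq]
  refine ⟨lowerEnd_mem_closure hb hx l, fun h => ?_⟩
  exact lt_irrefl _ ((update_mem_iff_mem_Ioo ho hc hb hx l _).1 h).1

theorem upperEnd_mem_frontier (ho : IsOpen Ω) (hc : Convex ℝ Ω) (hb : Bornology.IsBounded Ω)
    {x : Fin d → ℝ} (hx : x ∈ Ω) (l : Fin d) :
    Function.update x l (upperEnd Ω x l) ∈ frontier Ω := by
  rw [ho.frontier_eq]
  refine ⟨upperEnd_mem_closure hb hx l, fun h => ?_⟩
  exact lt_irrefl _ ((update_mem_iff_mem_Ioo ho hc hb hx l _).1 h).2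

theorem update_mem_closure_of_mem_Icc (hc : Convex ℝ Ω) (hb : Bornology.IsBounded Ω)
    {x : Fin d → ℝ} (hx : x ∈ Ω) (l : Fin d) {ξ : ℝ}
    (hξ : ξ ∈ Icc (lowerEnd Ω x l) (upperEnd Ω x l)) : Function.update x l ξ ∈ closure Ω := by
  rcases eq_or_lt_of_le hξ.1 with h | h
  · rw [← h]; exact lowerEnd_mem_closure hb hx l
  rcases eq_or_lt_of_le hξ.2 with h' | h'
  · rw [h']; exact upperEnd_mem_closure hb hx l
  have hs : ξ ∈ openSegment ℝ (lowerEnd Ω x l) (upperEnd Ω x l) := by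
    rw [openSegment_eq_Ioo (h.trans h')]; exact ⟨h, h'⟩
  exact hc.closure.openSegment_subset (lowerEnd_mem_closure hb hx l) (upperEnd_mem_closure hb hx l)
    (mem_openSegment_update hs)

theorem contDiffOn_lineSlice (ho : IsOpen Ω) (hc : Convex ℝ Ω) (hb : Bornology.IsBounded Ω)
    {v : (Fin d → ℝ) → ℝ} (hv : ContDiffOn ℝ 2 v Ω) {x : Fin d → ℝ} (hx : x ∈ Ω) (l : Fin d) :
    ContDiffOn ℝ 2 (lineSlice v x l) (Ioo (lowerEnd Ω x l) (upperEnd Ω x l)) :=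
  hv.comp (contDiff_update 2 x l).contDiffOn fun ξ hξ =>
    (update_mem_iff_mem_Ioo ho hc hb hx l ξ).2 hξ

theorem continuousOn_lineSlice (hc : Convex ℝ Ω) (hb : Bornology.IsBounded Ω)
    {v : (Fin d → ℝ) → ℝ} (hv : ContinuousOn v (closure Ω)) {x : Fin d → ℝ} (hx : x ∈ Ω)
    (l : Fin d) : ContinuousOn (lineSlice v x l) (Icc (lowerEnd Ω x l) (upperEnd Ω x l)) :=
  hv.comp (continuous_update_coord x l).continuousOn fun _ hξ =>
    update_mem_closure_of_mem_Icc hc hb hx l hξ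

theorem deriv_lineSlice (ho : IsOpen Ω) {v : (Fin d → ℝ) → ℝ} (hv : ContDiffOn ℝ 2 v Ω)
    {x : Fin d → ℝ} {l : Fin d} {ξ : ℝ} (hξ : Function.update x l ξ ∈ Ω) :
    deriv (lineSlice v x l) ξ = fderiv ℝ v (Function.update x l ξ) (Pi.single l 1) := by
  have h1 : HasFDerivAt v (fderiv ℝ v (Function.update x l ξ)) (Function.update x l ξ) :=
    ((hv.differentiableOn two_ne_zero _ hξ).differentiableAt (ho.mem_nhds hξ)).hasFDerivAt
  exact (h1.comp_hasDerivAt ξ (hasDerivAt_update x l ξ)).deriv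

/-- The integral over `Ω` is nonpositive if the integrals over all chords in one coordinate
direction are. -/
theorem setIntegral_nonpos_of_chords (hΩ : MeasurableSet Ω) (l : Fin d) {F : (Fin d → ℝ) → ℝ}
    (hF : IntegrableOn F Ω)
    (h : ∀ x ∈ Ω, ∫ ξ in {ξ : ℝ | Function.update x l ξ ∈ Ω}, F (Function.update x l ξ) ≤ 0) :
    ∫ x in Ω, F x ≤ 0 := by
  obtain _ | n := d
  · exact l.elim0
  rw [← integral_indicator hΩ]
  have hF' : Integrable (Ω.indicator F) := (integrable_indicator_iff hΩ).2 hF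
  have hmp := (volume_preserving_piFinSuccAbove (fun _ : Fin (n + 1) => ℝ) l).symm
  rw [← hmp.integral_comp (MeasurableEquiv.measurableEmbedding _)]
  have hi : Integrable (fun p => Ω.indicator F
      ((MeasurableEquiv.piFinSuccAbove (fun _ : Fin (n + 1) => ℝ) l).symm p))
      (volume.prod volume) :=
    hmp.integrable_comp_of_integrable hF'
  refine (integral_prod_symm _ hi).trans_le ?_
  refine integral_nonpos fun y => ?_
  simp only [Pi.zero_apply]
  -- Either the line over `y` misses `Ω`, or any of its points in `Ω` serves as base point for the
  -- chord hypothesis.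
  by_cases hy : ∃ ξ₀ : ℝ, l.insertNth ξ₀ y ∈ Ω
  · obtain ⟨ξ₀, hξ₀⟩ := hy
    refine le_trans (le_of_eq ?_) (h _ hξ₀)
    have hm : MeasurableSet {ξ : ℝ | Function.update (l.insertNth ξ₀ y) l ξ ∈ Ω} :=
      (continuous_update_coord _ l).measurable hΩ
    rw [← integral_indicator hm]
    congr 1 with ξ
    have : (MeasurableEquiv.piFinSuccAbove (fun _ : Fin (n + 1) => ℝ) l).symm (ξ, y)
        = Function.update (l.insertNth ξ₀ y) l ξ := by
      rw [Fin.update_insertNth]; rfl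
    rw [this]
    simp only [indicator, mem_ofPred_eq]
  · push Not at hy
    refine le_of_eq (integral_eq_zero_of_ae (Eventually.of_forall fun ξ => ?_))
    exact indicator_of_notMem (hy ξ) _

end Chords

/-! ### The space operator -/

theorem intervalIntegrable_rpow_inv {γ c : ℝ} (hγ1 : γ < 1) (hc : 0 ≤ c) :
    IntervalIntegrable (fun s : ℝ => (s ^ γ)⁻¹) volume 0 c := by
  rw [intervalIntegrable_iff_integrableOn_Ioc_of_le hc]
  refine IntegrableOn.congr_fun ((intervalIntegrable_iff_integrableOn_Ioc_of_le hc).1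
    (intervalIntegral.intervalIntegrable_rpow' (r := -γ) (by linarith)))
    (fun s hs => ?_) measurableSet_Ioc
  exact Real.rpow_neg hs.1.le γ

/-- The two possible singularities are apart: `h` may blow up only at `L`, the kernel only at `x`.
Splitting at a point between them leaves, on each half, an integrable factor times a continuous one.
-/
theorem intervalIntegrable_div_rpow_left {L R γ x : ℝ} {h : ℝ → ℝ} (hγ1 : γ < 1)
    (hh : IntegrableOn h (Ioo L R)) (hc : ContinuousOn h (Ioo L R)) (hx : x ∈ Ioo L R) :
    IntervalIntegrable (fun ξ => h ξ / (x - ξ) ^ γ) volume L x := by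
  obtain ⟨m, hLm, hmx⟩ := exists_between hx.1
  have hi : IntervalIntegrable h volume L R :=
    (intervalIntegrable_iff_integrableOn_Ioo_of_le (hx.1.trans hx.2).le).2 hh
  simp only [div_eq_mul_inv]
  refine IntervalIntegrable.trans (b := m) ?_ ?_
  · refine IntervalIntegrable.mul_continuousOn (hi.mono_set ?_) ?_
    · rw [uIcc_of_le hLm.le, uIcc_of_le (hx.1.trans hx.2).le]
      exact Icc_subset_Icc_right (hmx.trans hx.2).le
    · rw [uIcc_of_le hLm.le]
      have hne : ∀ ξ ∈ Icc L m, x - ξ ≠ 0 := fun ξ hξ => by linarith [hξ.2]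
      refine ContinuousOn.inv₀ (ContinuousOn.rpow_const (by fun_prop) fun ξ hξ =>
        Or.inl (hne ξ hξ)) fun ξ hξ => ?_
      exact (Real.rpow_pos_of_pos (by linarith [hξ.2]) _).ne'
  · refine IntervalIntegrable.continuousOn_mul ?_ (hc.mono ?_)
    · have := (intervalIntegrable_rpow_inv (c := x - m) hγ1 (by linarith)).comp_sub_left x
        (by finiteness)
      simpa using this.symm
    · rw [uIcc_of_le hmx.le]
      exact fun ξ hξ => ⟨hLm.trans_le hξ.1, hξ.2.trans_lt hx.2⟩

theorem intervalIntegrable_div_rpow_right {L R γ x : ℝ} {h : ℝ → ℝ} (hγ1 : γ < 1)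
    (hh : IntegrableOn h (Ioo L R)) (hc : ContinuousOn h (Ioo L R)) (hx : x ∈ Ioo L R) :
    IntervalIntegrable (fun ξ => h ξ / (ξ - x) ^ γ) volume x R := by
  have hLR := (hx.1.trans hx.2).le
  have hi : IntervalIntegrable h volume L R :=
    (intervalIntegrable_iff_integrableOn_Ioo_of_le hLR).2 hh
  have hi' : IntegrableOn (fun ξ => h (-ξ)) (Ioo (-R) (-L)) :=
    (intervalIntegrable_iff_integrableOn_Ioo_of_le (by linarith)).1
      ((IntervalIntegrable.iff_comp_neg (by finiteness)).1 hi).symm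
  have hc' : ContinuousOn (fun ξ => h (-ξ)) (Ioo (-R) (-L)) :=
    hc.comp continuousOn_neg fun ξ hξ => ⟨by linarith [hξ.2], by linarith [hξ.1]⟩
  have := intervalIntegrable_div_rpow_left (x := -x) hγ1 hi' hc'
    ⟨by linarith [hx.2], by linarith [hx.1]⟩
  rw [IntervalIntegrable.iff_comp_neg (by finiteness)]
  refine this.symm.congr fun ξ _ => ?_
  congr 2
  ring

section

variable {d : ℕ} {Ω : Set (Fin d → ℝ)}

theorem continuousOn_iteratedDeriv_lineSlice (ho : IsOpen Ω) (hc : Convex ℝ Ω)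
    (hb : Bornology.IsBounded Ω) {v : (Fin d → ℝ) → ℝ} (hv : ContDiffOn ℝ 2 v Ω)
    {x : Fin d → ℝ} (hx : x ∈ Ω) (l : Fin d) :
    ContinuousOn (iteratedDeriv 2 (lineSlice v x l))
      (Ioo (lowerEnd Ω x l) (upperEnd Ω x l)) := by
  have h2 := contDiffOn_lineSlice ho hc hb hv hx l
  rw [← one_add_one_eq_two, contDiffOn_succ_iff_deriv_of_isOpen isOpen_Ioo] at h2
  have h3 := h2.2.2.continuousOn_deriv_of_isOpen isOpen_Ioo le_rfl
  rwa [iteratedDeriv_succ, iteratedDeriv_one]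

theorem iteratedDeriv_lineSlice_sub (ho : IsOpen Ω) (hc : Convex ℝ Ω)
    (hb : Bornology.IsBounded Ω) {v w : (Fin d → ℝ) → ℝ} (hv : ContDiffOn ℝ 2 v Ω)
    (hw : ContDiffOn ℝ 2 w Ω) {x : Fin d → ℝ} (hx : x ∈ Ω) (l : Fin d) {ξ : ℝ}
    (hξ : ξ ∈ Ioo (lowerEnd Ω x l) (upperEnd Ω x l)) :
    iteratedDeriv 2 (lineSlice (fun y => v y - w y) x l) ξ
      = iteratedDeriv 2 (lineSlice v x l) ξ - iteratedDeriv 2 (lineSlice w x l) ξ := by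
  have h1 := (contDiffOn_lineSlice ho hc hb hv hx l).contDiffAt (isOpen_Ioo.mem_nhds hξ)
  have h2 := (contDiffOn_lineSlice ho hc hb hw hx l).contDiffAt (isOpen_Ioo.mem_nhds hξ)
  exact iteratedDeriv_sub h1 h2

variable {α : Fin d → ℝ} {v w : (Fin d → ℝ) → ℝ}

theorem spaceDerivLeft_sub (ho : IsOpen Ω) (hc : Convex ℝ Ω) (hb : Bornology.IsBounded Ω)
    (hα : ∀ l, 1 < α l ∧ α l ≤ 2) (hv : SpaceRegular Ω α v) (hw : SpaceRegular Ω α w) (l : Fin d)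
    {x : Fin d → ℝ} (hx : x ∈ Ω) :
    spaceDerivLeft Ω (α l) l (fun y => v y - w y) x
      = spaceDerivLeft Ω (α l) l v x - spaceDerivLeft Ω (α l) l w x := by
  have hm := coord_mem_Ioo ho hc hb hx l
  unfold spaceDerivLeft
  split_ifs with h2
  · exact iteratedDeriv_lineSlice_sub ho hc hb hv.contDiffOn hw.contDiffOn hx l hm
  · have hγ : α l - 1 < 1 := by
      have := lt_of_le_of_ne (hα l).2 h2
      linarith
    rw [← mul_sub, ← intervalIntegral.integral_sub
      (intervalIntegrable_div_rpow_left hγ (hv.integrableOn_chord x hx l)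
        (continuousOn_iteratedDeriv_lineSlice ho hc hb hv.contDiffOn hx l) hm)
      (intervalIntegrable_div_rpow_left hγ (hw.integrableOn_chord x hx l)
        (continuousOn_iteratedDeriv_lineSlice ho hc hb hw.contDiffOn hx l) hm)]
    congr 1
    simp only [intervalIntegral.integral_of_le hm.1.le, integral_Ioc_eq_integral_Ioo]
    refine setIntegral_congr_fun measurableSet_Ioo fun ξ hξ => ?_
    rw [iteratedDeriv_lineSlice_sub ho hc hb hv.contDiffOn hw.contDiffOn hx l
      ⟨hξ.1, hξ.2.trans hm.2⟩, sub_div]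

theorem spaceDerivRight_sub (ho : IsOpen Ω) (hc : Convex ℝ Ω) (hb : Bornology.IsBounded Ω)
    (hα : ∀ l, 1 < α l ∧ α l ≤ 2) (hv : SpaceRegular Ω α v) (hw : SpaceRegular Ω α w) (l : Fin d)
    {x : Fin d → ℝ} (hx : x ∈ Ω) :
    spaceDerivRight Ω (α l) l (fun y => v y - w y) x
      = spaceDerivRight Ω (α l) l v x - spaceDerivRight Ω (α l) l w x := by
  have hm := coord_mem_Ioo ho hc hb hx l
  unfold spaceDerivRight
  split_ifs with h2
  · exact iteratedDeriv_lineSlice_sub ho hc hb hv.contDiffOn hw.contDiffOn hx l hm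
  · have hγ : α l - 1 < 1 := by
      have := lt_of_le_of_ne (hα l).2 h2
      linarith
    rw [← mul_sub, ← intervalIntegral.integral_sub
      (intervalIntegrable_div_rpow_right hγ (hv.integrableOn_chord x hx l)
        (continuousOn_iteratedDeriv_lineSlice ho hc hb hv.contDiffOn hx l) hm)
      (intervalIntegrable_div_rpow_right hγ (hw.integrableOn_chord x hx l)
        (continuousOn_iteratedDeriv_lineSlice ho hc hb hw.contDiffOn hx l) hm)]
    congr 1
    simp only [intervalIntegral.integral_of_le hm.2.le, integral_Ioc_eq_integral_Ioo]
    refine setIntegral_congr_fun measurableSet_Ioo fun ξ hξ => ?_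
    rw [iteratedDeriv_lineSlice_sub ho hc hb hv.contDiffOn hw.contDiffOn hx l
      ⟨hm.1.trans hξ.1, hξ.2⟩, sub_div]

theorem SpaceRegular.sub (ho : IsOpen Ω) (hc : Convex ℝ Ω) (hb : Bornology.IsBounded Ω)
    (hα : ∀ l, 1 < α l ∧ α l ≤ 2) (hv : SpaceRegular Ω α v) (hw : SpaceRegular Ω α w) :
    SpaceRegular Ω α (fun y => v y - w y) where
  continuousOn := hv.continuousOn.sub hw.continuousOn
  contDiffOn := hv.contDiffOn.sub hw.contDiffOn
  integrableOn_chord x hx l :=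
    IntegrableOn.congr_fun ((hv.integrableOn_chord x hx l).sub (hw.integrableOn_chord x hx l))
      (fun _ hξ => (iteratedDeriv_lineSlice_sub ho hc hb hv.contDiffOn hw.contDiffOn hx l hξ).symm)
      measurableSet_Ioo
  memLp_left l := by
    refine ((hv.memLp_left l).sub (hw.memLp_left l)).ae_eq ?_
    filter_upwards [ae_restrict_mem ho.measurableSet] with x hx
    exact (spaceDerivLeft_sub ho hc hb hα hv hw l hx).symm
  memLp_right l := by
    refine ((hv.memLp_right l).sub (hw.memLp_right l)).ae_eq ?_
    filter_upwards [ae_restrict_mem ho.measurableSet] with x hx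
    exact (spaceDerivRight_sub ho hc hb hα hv hw l hx).symm

theorem spaceOp_sub (ho : IsOpen Ω) (hc : Convex ℝ Ω) (hb : Bornology.IsBounded Ω)
    (hα : ∀ l, 1 < α l ∧ α l ≤ 2) (hv : SpaceRegular Ω α v) (hw : SpaceRegular Ω α w)
    (εp εm : Fin d → ℝ) {x : Fin d → ℝ} (hx : x ∈ Ω) :
    spaceOp Ω α εp εm (fun y => v y - w y) x = spaceOp Ω α εp εm v x - spaceOp Ω α εp εm w x := by
  simp only [spaceOp, spaceDerivLeft_sub ho hc hb hα hv hw _ hx,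
    spaceDerivRight_sub ho hc hb hα hv hw _ hx, mul_sub, Finset.sum_sub_distrib]
  ring

theorem PartialZeroOnBoundary.sub (ho : IsOpen Ω) {l : Fin d} (hv : ContDiffOn ℝ 2 v Ω)
    (hw : ContDiffOn ℝ 2 w Ω) (hv0 : PartialZeroOnBoundary Ω l v)
    (hw0 : PartialZeroOnBoundary Ω l w) :
    PartialZeroOnBoundary Ω l (fun y => v y - w y) := by
  intro x hx
  have h := (hv0 x hx).sub (hw0 x hx)
  rw [sub_zero] at h
  refine h.congr' ?_
  filter_upwards [self_mem_nhdsWithin] with y hy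
  have h1 := (hv.differentiableOn two_ne_zero y hy).differentiableAt (ho.mem_nhds hy)
  have h2 := (hw.differentiableOn two_ne_zero y hy).differentiableAt (ho.mem_nhds hy)
  rw [fderiv_fun_sub h1 h2]
  rfl

/-! ### Dissipativity of the space operator -/

theorem tendsto_deriv_lineSlice (ho : IsOpen Ω) (hc : Convex ℝ Ω) (hb : Bornology.IsBounded Ω)
    {l : Fin d} (hv : ContDiffOn ℝ 2 v Ω) (h0 : PartialZeroOnBoundary Ω l v)
    {x : Fin d → ℝ} (hx : x ∈ Ω) {ξ₀ : ℝ} (hξ₀ : Function.update x l ξ₀ ∈ frontier Ω) :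
    Tendsto (deriv (lineSlice v x l)) (𝓝[Ioo (lowerEnd Ω x l) (upperEnd Ω x l)] ξ₀) (𝓝 0) := by
  have ht : Tendsto (fun ξ => Function.update x l ξ)
      (𝓝[Ioo (lowerEnd Ω x l) (upperEnd Ω x l)] ξ₀) (𝓝[Ω] (Function.update x l ξ₀)) :=
    tendsto_nhdsWithin_of_tendsto_nhds_of_eventually_within _
      ((continuous_update_coord x l).continuousAt.tendsto.mono_left nhdsWithin_le_nhds)
      (by
        filter_upwards [self_mem_nhdsWithin] with ξ hξ
        exact (update_mem_iff_mem_Ioo ho hc hb hx l ξ).2 hξ)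
  refine ((h0 _ hξ₀).comp ht).congr' ?_
  filter_upwards [self_mem_nhdsWithin] with ξ hξ
  exact (deriv_lineSlice ho hv ((update_mem_iff_mem_Ioo ho hc hb hx l ξ).2 hξ)).symm

theorem continuous_eq_zero_of_tendsto {f g : ℝ → ℝ} {s : Set ℝ} {a : ℝ} (hf : Continuous f)
    (hfg : ∀ x ∈ s, f x = g x) (ha : a ∈ closure s) (hg : Tendsto g (𝓝[s] a) (𝓝 0)) : f a = 0 := by
  have : (𝓝[s] a).NeBot := mem_closure_iff_nhdsWithin_neBot.1 ha
  refine tendsto_nhds_unique (hf.continuousAt.tendsto.mono_left nhdsWithin_le_nhds) (hg.congr' ?_)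
  filter_upwards [self_mem_nhdsWithin] with x hx using (hfg x hx).symm

/-- Along a chord the slice and both ends do not depend on the base point, so the integrals are
exactly those of the one-dimensional inequalities. The boundary condition on `∂v/∂x_l` makes the
extended derivative `w` vanish at both ends: the left kernel uses the lower end, the right kernel
the upper one. -/
theorem chord_integral_nonpos (ho : IsOpen Ω) (hc : Convex ℝ Ω) (hb : Bornology.IsBounded Ω)
    (hα : ∀ l, 1 < α l ∧ α l ≤ 2) (hv : SpaceRegular Ω α v) (h0 : ∀ x ∈ frontier Ω, v x = 0)
    (l : Fin d) (hp : α l < 2 → PartialZeroOnBoundary Ω l v) {x : Fin d → ℝ} (hx : x ∈ Ω) :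
    (∫ ξ in {ξ : ℝ | Function.update x l ξ ∈ Ω}, v (Function.update x l ξ) *
      spaceDerivLeft Ω (α l) l v (Function.update x l ξ) ≤ 0) ∧
    ∫ ξ in {ξ : ℝ | Function.update x l ξ ∈ Ω}, v (Function.update x l ξ) *
      spaceDerivRight Ω (α l) l v (Function.update x l ξ) ≤ 0 := by
  have hS : {ξ : ℝ | Function.update x l ξ ∈ Ω} = Ioo (lowerEnd Ω x l) (upperEnd Ω x l) :=
    Set.ext fun ξ => update_mem_iff_mem_Ioo ho hc hb hx l ξ
  rw [hS]
  have hm := coord_mem_Ioo ho hc hb hx l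
  have hL := lowerEnd_mem_frontier ho hc hb hx l
  have hR := upperEnd_mem_frontier ho hc hb hx l
  have hvL : lineSlice v x l (lowerEnd Ω x l) = 0 := h0 _ hL
  have hvR : lineSlice v x l (upperEnd Ω x l) = 0 := h0 _ hR
  have hLR : lowerEnd Ω x l < upperEnd Ω x l := hm.1.trans hm.2
  have hcont := continuousOn_lineSlice hc hb hv.continuousOn hx l
  have hint := hv.integrableOn_chord x hx l
  obtain ⟨w, hw, hwe, hd1, hd2⟩ := exists_continuous_extension_deriv hLR
    (contDiffOn_lineSlice ho hc hb hv.contDiffOn hx l) hint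
  simp only [spaceDerivLeft, spaceDerivRight, lineSlice_update, lowerEnd_update, upperEnd_update,
    Function.update_self]
  change (∫ ξ in Ioo _ _, lineSlice v x l ξ * _ ≤ 0) ∧ ∫ ξ in Ioo _ _, lineSlice v x l ξ * _ ≤ 0
  by_cases h2 : α l = 2
  · simp only [if_pos h2]
    have := integral_mul_second_deriv_nonpos hLR.le hcont hw hd1 hd2 hint hvL hvR
    exact ⟨this, this⟩
  · have h2' := lt_of_le_of_ne (hα l).2 h2
    have hγ0 : 0 < α l - 1 := by linarith [(hα l).1]
    have hγ1 : α l - 1 < 1 := by linarith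
    have hcl := closure_Ioo hLR.ne
    have hwL : w (lowerEnd Ω x l) = 0 := continuous_eq_zero_of_tendsto hw hwe
      (by rw [hcl]; exact left_mem_Icc.2 hLR.le)
      (tendsto_deriv_lineSlice ho hc hb hv.contDiffOn (hp h2') hx hL)
    have hwR : w (upperEnd Ω x l) = 0 := continuous_eq_zero_of_tendsto hw hwe
      (by rw [hcl]; exact right_mem_Icc.2 hLR.le)
      (tendsto_deriv_lineSlice ho hc hb hv.contDiffOn (hp h2') hx hR)
    have hG : 0 ≤ 1 / Real.Gamma (2 - α l) :=
      (one_div_pos.2 (Real.Gamma_pos_of_pos (by linarith))).le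
    simp only [if_neg h2, mul_left_comm _ (1 / Real.Gamma (2 - α l)), integral_const_mul]
    exact ⟨mul_nonpos_of_nonneg_of_nonpos hG (integral_mul_rpow_convolution_nonpos hLR.le hγ0 hγ1
        hcont hw hd1 hd2 hint hvL hvR hwL),
      mul_nonpos_of_nonneg_of_nonpos hG (integral_mul_rpow_convolution_right_nonpos hLR.le hγ0 hγ1
        hcont hw hd1 hd2 hint hvL hvR hwR)⟩

theorem isFiniteMeasure_restrict_of_isBounded (hb : Bornology.IsBounded Ω) :
    IsFiniteMeasure (volume.restrict Ω) :=
  isFiniteMeasure_restrict.2 hb.measure_lt_top.ne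

theorem exists_abs_le_of_continuousOn_closure (hb : Bornology.IsBounded Ω)
    (hv : ContinuousOn v (closure Ω)) : ∃ B, ∀ x ∈ Ω, |v x| ≤ B := by
  have hK : IsCompact (closure Ω) := Metric.isCompact_of_isClosed_isBounded isClosed_closure
    hb.closure
  obtain ⟨B, hB⟩ := hK.exists_bound_of_continuousOn hv
  exact ⟨B, fun x hx => hB x (subset_closure hx)⟩

theorem integrableOn_mul_of_continuousOn_closure (ho : IsOpen Ω) (hb : Bornology.IsBounded Ω)
    (hv : ContinuousOn v (closure Ω)) {F : (Fin d → ℝ) → ℝ} (hF : MemLp F 2 (volume.restrict Ω)) :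
    IntegrableOn (fun x => v x * F x) Ω := by
  have := isFiniteMeasure_restrict_of_isBounded hb
  obtain ⟨B, hB⟩ := exists_abs_le_of_continuousOn_closure hb hv
  refine (hF.integrable one_le_two).bdd_mul (c := B)
    ((hv.mono subset_closure).aestronglyMeasurable ho.measurableSet) ?_
  filter_upwards [ae_restrict_mem ho.measurableSet] with x hx using hB x hx

theorem integrableOn_mul_spaceOp (ho : IsOpen Ω) (hb : Bornology.IsBounded Ω)
    (hv : SpaceRegular Ω α v) (εp εm : Fin d → ℝ) :
    IntegrableOn (fun x => v x * spaceOp Ω α εp εm v x) Ω := by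
  simp only [spaceOp, mul_add, Finset.mul_sum, mul_left_comm (v _)]
  exact (integrable_finsetSum _ fun l _ => (integrableOn_mul_of_continuousOn_closure ho hb
      hv.continuousOn (hv.memLp_left l)).const_mul _).add
    (integrable_finsetSum _ fun l _ => (integrableOn_mul_of_continuousOn_closure ho hb
      hv.continuousOn (hv.memLp_right l)).const_mul _)

theorem integral_mul_spaceOp_nonpos (ho : IsOpen Ω) (hc : Convex ℝ Ω)
    (hb : Bornology.IsBounded Ω) (hα : ∀ l, 1 < α l ∧ α l ≤ 2) {εp εm : Fin d → ℝ}
    (hεp : ∀ l, 0 ≤ εp l) (hεm : ∀ l, 0 ≤ εm l) (hv : SpaceRegular Ω α v)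
    (h0 : ∀ x ∈ frontier Ω, v x = 0) (hp : ∀ l, α l < 2 → PartialZeroOnBoundary Ω l v) :
    ∫ x in Ω, v x * spaceOp Ω α εp εm v x ≤ 0 := by
  have i1 : ∀ l, IntegrableOn (fun x => v x * spaceDerivLeft Ω (α l) l v x) Ω := fun l =>
    integrableOn_mul_of_continuousOn_closure ho hb hv.continuousOn (hv.memLp_left l)
  have i2 : ∀ l, IntegrableOn (fun x => v x * spaceDerivRight Ω (α l) l v x) Ω := fun l =>
    integrableOn_mul_of_continuousOn_closure ho hb hv.continuousOn (hv.memLp_right l)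
  simp only [spaceOp, mul_add, Finset.mul_sum, mul_left_comm (v _)]
  rw [integral_add (integrable_finsetSum _ fun l _ => (i1 l).const_mul _)
      (integrable_finsetSum _ fun l _ => (i2 l).const_mul _),
    integral_finsetSum _ fun l _ => (i1 l).const_mul _,
    integral_finsetSum _ fun l _ => (i2 l).const_mul _]
  simp only [integral_const_mul]
  refine add_nonpos (Finset.sum_nonpos fun l _ => ?_) (Finset.sum_nonpos fun l _ => ?_)
  · exact mul_nonpos_of_nonneg_of_nonpos (hεp l) (setIntegral_nonpos_of_chords ho.measurableSet l
      (i1 l) fun x hx => (chord_integral_nonpos ho hc hb hα hv h0 l (hp l) hx).1)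
  · exact mul_nonpos_of_nonneg_of_nonpos (hεm l) (setIntegral_nonpos_of_chords ho.measurableSet l
      (i2 l) fun x hx => (chord_integral_nonpos ho hc hb hα hv h0 l (hp l) hx).2)

end

/-! ### Grünwald coefficients and their partial sums -/

/-- The partial sums of the Grünwald coefficients. -/
noncomputable def glPartial (θ : ℝ) (j : ℕ) : ℝ := ∑ k ∈ Finset.range (j + 1), glCoeff θ k

theorem glPartial_zero (θ : ℝ) : glPartial θ 0 = 1 := by simp [glPartial, glCoeff]

theorem glPartial_succ_eq_add (θ : ℝ) (j : ℕ) :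
    glPartial θ (j + 1) = glPartial θ j + glCoeff θ (j + 1) := by
  simp only [glPartial, Finset.sum_range_succ]

/-- In terms of generating functions, `ω` belongs to `(1 - z) ^ θ` and its partial sums to `(1 - z)
^ (θ - 1)`; the identity is differentiation of the former. It yields the recursion and the sign of
the partial sums, and from these the sign of `ω_k`. -/
theorem succ_mul_glCoeff_succ (θ : ℝ) (k : ℕ) :
    ((k : ℝ) + 1) * glCoeff θ (k + 1) = -θ * glPartial θ k := by
  induction k with
  | zero => simp [glPartial, glCoeff]
  | succ k ih =>
    rw [glPartial_succ_eq_add, mul_add, ← ih, glCoeff]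
    have : (k : ℝ) + 1 + 1 ≠ 0 := by positivity
    push_cast
    field_simp
    ring

theorem succ_mul_glPartial_succ (θ : ℝ) (k : ℕ) :
    ((k : ℝ) + 1) * glPartial θ (k + 1) = ((k : ℝ) + 1 - θ) * glPartial θ k := by
  rw [glPartial_succ_eq_add, mul_add, succ_mul_glCoeff_succ]; ring

theorem glPartial_nonneg {θ : ℝ} (hθ : θ ≤ 1) (k : ℕ) : 0 ≤ glPartial θ k := by
  induction k with
  | zero => rw [glPartial_zero]; exact zero_le_one
  | succ k ih =>
    have h := succ_mul_glPartial_succ θ k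
    have hk : (0 : ℝ) < (k : ℝ) + 1 := by positivity
    have : 0 ≤ ((k : ℝ) + 1) * glPartial θ (k + 1) := by
      rw [h]
      exact mul_nonneg (by have : (0 : ℝ) ≤ k := k.cast_nonneg; linarith) ih
    exact nonneg_of_mul_nonneg_right this hk

theorem glCoeff_succ_nonpos {θ : ℝ} (h0 : 0 ≤ θ) (hθ : θ ≤ 1) (k : ℕ) :
    glCoeff θ (k + 1) ≤ 0 := by
  have h := succ_mul_glCoeff_succ θ k
  have hk : (0 : ℝ) < (k : ℝ) + 1 := by positivity
  have : ((k : ℝ) + 1) * glCoeff θ (k + 1) ≤ 0 := by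
    rw [h]; nlinarith [glPartial_nonneg hθ k]
  exact nonpos_of_mul_nonpos_right this hk

theorem sum_glPartial (θ : ℝ) (n : ℕ) :
    (1 - θ) * ∑ j ∈ Finset.range (n + 1), glPartial θ j = ((n : ℝ) + 1 - θ) * glPartial θ n := by
  induction n with
  | zero => simp
  | succ n ih =>
    rw [Finset.sum_range_succ, mul_add, ih, ← succ_mul_glPartial_succ]
    push_cast
    ring

theorem glPartial_eq_Gamma {θ : ℝ} (hθ : θ < 1) (n : ℕ) :
    glPartial θ n = Real.Gamma (n + 1 - θ) / (Real.Gamma (1 - θ) * Real.Gamma (n + 1)) := by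
  induction n with
  | zero =>
    have : Real.Gamma (1 - θ) ≠ 0 := (Real.Gamma_pos_of_pos (by linarith)).ne'
    simp [glPartial_zero, this]
  | succ n ih =>
    have hn : (0 : ℝ) ≤ n := n.cast_nonneg
    have h1 : (n : ℝ) + 1 - θ ≠ 0 := by linarith
    have h2 : (n : ℝ) + 1 ≠ 0 := by positivity
    have h3 : Real.Gamma ((n : ℝ) + 1) ≠ 0 := (Real.Gamma_pos_of_pos (by positivity)).ne'
    have h4 : Real.Gamma (1 - θ) ≠ 0 := (Real.Gamma_pos_of_pos (by linarith)).ne'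
    have h := succ_mul_glPartial_succ θ n
    rw [ih] at h
    push_cast
    rw [show (n : ℝ) + 1 + 1 - θ = ((n : ℝ) + 1 - θ) + 1 by ring, Real.Gamma_add_one h1,
      Real.Gamma_add_one h2]
    apply mul_left_cancel₀ h2
    rw [h]
    field_simp

/-- The sum of the first `n` partial sums differs from `n^{1-θ} / Γ(2-θ)` by at most the last of
them. -/
theorem abs_sum_glPartial_sub_le {θ : ℝ} (h0 : 0 < θ) (hθ : θ < 1) (n : ℕ) :
    |∑ j ∈ Finset.range (n + 1), glPartial θ j - ((n : ℝ) + 1) ^ (1 - θ) / Real.Gamma (2 - θ)|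
      ≤ glPartial θ n := by
  have hn : (0 : ℝ) ≤ n := n.cast_nonneg
  set m : ℝ := (n : ℝ) + 1 with hm
  have hm1 : 1 ≤ m := by linarith
  have hm0 : 0 < m := by linarith
  set x : ℝ := m - θ with hx
  have hx0 : 0 < x := by linarith
  have hd : 0 < 1 - θ := by linarith
  have hGd := Real.Gamma_pos_of_pos hd
  have hGx := Real.Gamma_pos_of_pos hx0
  have hGm := Real.Gamma_pos_of_pos hm0
  have hG2 : Real.Gamma (2 - θ) = (1 - θ) * Real.Gamma (1 - θ) := by
    rw [← Real.Gamma_add_one hd.ne']; congr 1; ring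
  have hb : glPartial θ n = Real.Gamma x / (Real.Gamma (1 - θ) * Real.Gamma m) :=
    glPartial_eq_Gamma hθ n
  have hS : ∑ j ∈ Finset.range (n + 1), glPartial θ j = x * glPartial θ n / (1 - θ) := by
    rw [eq_div_iff hd.ne', mul_comm, sum_glPartial]
  -- Log-convexity of `Γ` at `x + 1 = θ m + (1 - θ) (m + 1)`. The next bound uses it at `m = (1 - θ)
  -- x + θ (x + 1)`.
  have hup : x * Real.Gamma x ≤ Real.Gamma m * m ^ (1 - θ) := by
    have := Real.Gamma_mul_add_mul_le_rpow_Gamma_mul_rpow_Gamma hm0 (by linarith : 0 < m + 1)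
      h0 hd (by ring)
    rw [show θ * m + (1 - θ) * (m + 1) = x + 1 by rw [hx]; ring, Real.Gamma_add_one hx0.ne',
      Real.Gamma_add_one hm0.ne', Real.mul_rpow hm0.le hGm.le, mul_comm (m ^ (1 - θ)), ← mul_assoc,
      ← Real.rpow_add hGm, add_sub_cancel, Real.rpow_one] at this
    exact this
  have hlow : Real.Gamma m ≤ Real.Gamma x * x ^ θ := by
    have := Real.Gamma_mul_add_mul_le_rpow_Gamma_mul_rpow_Gamma hx0 (by linarith : 0 < x + 1)
      hd h0 (by ring)
    rw [show (1 - θ) * x + θ * (x + 1) = m by rw [hx]; ring, Real.Gamma_add_one hx0.ne',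
      Real.mul_rpow hx0.le hGx.le, mul_comm (x ^ θ), ← mul_assoc,
      ← Real.rpow_add hGx, sub_add_cancel, Real.rpow_one] at this
    exact this
  -- Weighted AM-GM gives `(1 - θ) m + θ x = x + θ (1 - θ)`, which is at most `x + (1 - θ)`.
  have ham : m ^ (1 - θ) * x ^ θ ≤ x + (1 - θ) := by
    have := Real.geom_mean_le_arith_mean2_weighted hd.le h0.le hm0.le hx0.le (by ring)
    nlinarith
  have hup2 : m ^ (1 - θ) * Real.Gamma m ≤ (x + (1 - θ)) * Real.Gamma x := by
    calc m ^ (1 - θ) * Real.Gamma m ≤ m ^ (1 - θ) * (Real.Gamma x * x ^ θ) := by gcongr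
      _ = (m ^ (1 - θ) * x ^ θ) * Real.Gamma x := by ring
      _ ≤ _ := by gcongr
  have e : ∀ A : ℝ, A / ((1 - θ) * Real.Gamma (1 - θ))
      = A * Real.Gamma m / ((1 - θ) * Real.Gamma (1 - θ) * Real.Gamma m) := fun A => by
    field_simp
  have hDpos : 0 < (1 - θ) * Real.Gamma (1 - θ) * Real.Gamma m := by positivity
  have eS : x * glPartial θ n / (1 - θ)
      = x * Real.Gamma x / ((1 - θ) * Real.Gamma (1 - θ) * Real.Gamma m) := by
    rw [hb]; field_simp
  have eB : glPartial θ n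
      = (1 - θ) * Real.Gamma x / ((1 - θ) * Real.Gamma (1 - θ) * Real.Gamma m) := by
    rw [hb]; field_simp
  rw [hS, hG2, e, eS, eB, ← sub_div, abs_le, ← neg_div,
    div_le_div_iff_of_pos_right hDpos, div_le_div_iff_of_pos_right hDpos]
  have := mul_pos hd hGx
  constructor <;> nlinarith

/-- Summation by parts for a Grünwald sum. -/
theorem sum_glCoeff_mul (θ : ℝ) (y : ℕ → ℝ) (n : ℕ) :
    ∑ k ∈ Finset.range n, glCoeff θ k * (y (n - k) - y 0)
      = ∑ j ∈ Finset.range n, glPartial θ j * (y (n - j) - y (n - 1 - j)) := by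
  -- Replacing `y 0` by the moving base value `y (n - m)` makes the identity accessible to induction
  -- on `m`.
  have key : ∀ m, m ≤ n → ∑ k ∈ Finset.range m, glCoeff θ k * (y (n - k) - y (n - m))
      = ∑ j ∈ Finset.range m, glPartial θ j * (y (n - j) - y (n - 1 - j)) := by
    intro m hm
    induction m with
    | zero => simp
    | succ m ih =>
      rw [Finset.sum_range_succ, Finset.sum_range_succ _ m, ← ih (by omega)]
      have h1 : n - (m + 1) = n - 1 - m := by omega
      have h2 : ∑ k ∈ Finset.range m, glCoeff θ k * (y (n - k) - y (n - 1 - m))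
          = ∑ k ∈ Finset.range m, glCoeff θ k * (y (n - k) - y (n - m))
            + (∑ k ∈ Finset.range m, glCoeff θ k) * (y (n - m) - y (n - 1 - m)) := by
        rw [Finset.sum_mul, ← Finset.sum_add_distrib]
        exact Finset.sum_congr rfl fun k _ => by ring
      rw [h1, h2, glPartial, Finset.sum_range_succ]
      ring
  simpa using key n le_rfl

/-- The Grünwald sum of the function `1 + t`. -/
theorem sum_glCoeff_mul_one_add (θ τ : ℝ) (m : ℕ) :
    ∑ k ∈ Finset.range (m + 1), glCoeff θ k * (1 + ((m + 1 - k : ℕ) : ℝ) * τ)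
      = glPartial θ m + τ * ∑ j ∈ Finset.range (m + 1), glPartial θ j := by
  have h := sum_glCoeff_mul θ (fun i => (i : ℝ) * τ) (m + 1)
  have h1 : ∀ k ∈ Finset.range (m + 1), glCoeff θ k * (1 + ((m + 1 - k : ℕ) : ℝ) * τ)
      = glCoeff θ k + glCoeff θ k * (((m + 1 - k : ℕ) : ℝ) * τ - ((0 : ℕ) : ℝ) * τ) := by
    intro k _; push_cast; ring
  rw [Finset.sum_congr rfl h1, Finset.sum_add_distrib, h, glPartial, Finset.mul_sum]
  congr 1
  refine Finset.sum_congr rfl fun j hj => ?_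
  have hj' := Finset.mem_range.1 hj
  have : ((m + 1 - j : ℕ) : ℝ) = ((m + 1 - 1 - j : ℕ) : ℝ) + 1 := by
    rw [← Nat.cast_succ]; congr 1; omega
  rw [this]; ring

theorem sum_sub_mul_by_parts (B D : ℕ → ℝ) (hB : B 0 = 0) (m : ℕ) :
    ∑ j ∈ Finset.range (m + 1), (B (j + 1) - B j) * D j
      = B (m + 1) * D m - ∑ j ∈ Finset.range m, B (j + 1) * (D (j + 1) - D j) := by
  induction m with
  | zero => simp [hB]
  | succ m ih => rw [Finset.sum_range_succ, ih, Finset.sum_range_succ _ m]; ring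

/-! ### The truncation error -/

section Time

variable {T M : ℝ} {w : ℝ → ℝ}

theorem abs_derivWithin_sub_le (hT : 0 < T) (hw : ContDiffOn ℝ 2 w (Icc 0 T))
    (hM : ∀ t ∈ Icc 0 T, |iteratedDerivWithin 2 w (Icc 0 T) t| ≤ M) {x y : ℝ}
    (hx : x ∈ Icc 0 T) (hy : y ∈ Icc 0 T) :
    |derivWithin w (Icc 0 T) y - derivWithin w (Icc 0 T) x| ≤ M * |y - x| := by
  have hU := uniqueDiffOn_Icc hT
  have h1 : ContDiffOn ℝ 1 (derivWithin w (Icc 0 T)) (Icc 0 T) :=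
    hw.derivWithin hU (by norm_num)
  refine (convex_Icc 0 T).norm_image_sub_le_of_norm_derivWithin_le
    (h1.differentiableOn one_ne_zero) (fun t ht => ?_) hx hy
  have := hM t ht
  have e : iteratedDerivWithin 1 w (Icc 0 T) = derivWithin w (Icc 0 T) :=
    iteratedDerivWithin_one
  rwa [iteratedDerivWithin_succ, e] at this

/-- The freedom in `z` matters: inner points are needed for the quadrature error, end points for
differences of neighbouring increments and for the initial velocity. -/
theorem abs_sub_sub_derivWithin_mul_le (hT : 0 < T) (hw : ContDiffOn ℝ 2 w (Icc 0 T))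
    (hM : ∀ t ∈ Icc 0 T, |iteratedDerivWithin 2 w (Icc 0 T) t| ≤ M) {x y z : ℝ}
    (hx : 0 ≤ x) (hy : y ≤ T) (hz : z ∈ Icc x y) :
    |w y - w x - derivWithin w (Icc 0 T) z * (y - x)| ≤ M * (y - x) ^ 2 := by
  have hxy : x ≤ y := hz.1.trans hz.2
  have hM0 : 0 ≤ M := (abs_nonneg _).trans (hM 0 ⟨le_rfl, hT.le⟩)
  have hsub : Icc x y ⊆ Icc 0 T := Icc_subset_Icc hx hy
  have hd : ∀ t ∈ Icc x y, HasDerivWithinAt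
      (fun t => w t - derivWithin w (Icc 0 T) z * t)
      (derivWithin w (Icc 0 T) t - derivWithin w (Icc 0 T) z) (Icc x y) t := by
    intro t ht
    have h1 := ((hw.differentiableOn two_ne_zero t (hsub ht)).hasDerivWithinAt).mono hsub
    exact (h1.sub ((hasDerivWithinAt_id t _).const_mul _)).congr_deriv (by ring)
  have := (convex_Icc x y).norm_image_sub_le_of_norm_hasDerivWithin_le (C := M * (y - x)) hd
    (fun t ht => ?_) (left_mem_Icc.2 hxy) (right_mem_Icc.2 hxy)
  · rw [Real.norm_eq_abs, Real.norm_eq_abs, abs_of_nonneg (sub_nonneg.2 hxy)] at this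
    calc _ = |w y - derivWithin w (Icc 0 T) z * y - (w x - derivWithin w (Icc 0 T) z * x)| := by
          congr 1; ring
      _ ≤ _ := this
      _ = _ := by ring
  · refine (abs_derivWithin_sub_le hT hw hM (hsub hz) (hsub ht)).trans ?_
    gcongr
    rw [abs_le]
    constructor <;> linarith [ht.1, ht.2, hz.1, hz.2]

theorem integral_sub_rpow_neg {θ a b t : ℝ} (hθ : θ < 1) :
    ∫ ξ in a..b, (t - ξ) ^ (-θ) = ((t - a) ^ (1 - θ) - (t - b) ^ (1 - θ)) / (1 - θ) := by
  rw [intervalIntegral.integral_comp_sub_left (fun s => s ^ (-θ)) t,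
    integral_rpow (Or.inl (by linarith)), show -θ + 1 = 1 - θ by ring]

theorem intervalIntegrable_sub_rpow_neg {θ a b t : ℝ} (hθ : θ < 1) :
    IntervalIntegrable (fun ξ : ℝ => (t - ξ) ^ (-θ)) volume a b := by
  have := (intervalIntegral.intervalIntegrable_rpow' (a := t - a) (b := t - b) (r := -θ)
    (by linarith)).comp_sub_left t (by finiteness)
  simpa using this

theorem abs_integral_mul_rpow_sub_le {θ a b t D E : ℝ} {p : ℝ → ℝ} (hθ : θ < 1) (hab : a ≤ b)
    (hbt : b ≤ t) (hp : ContinuousOn p (Icc a b)) (hE : ∀ ξ ∈ Icc a b, |p ξ - D| ≤ E) :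
    |(∫ ξ in a..b, p ξ * (t - ξ) ^ (-θ)) - D * (((t - a) ^ (1 - θ) - (t - b) ^ (1 - θ)) / (1 - θ))|
      ≤ E * (((t - a) ^ (1 - θ) - (t - b) ^ (1 - θ)) / (1 - θ)) := by
  have hk : IntervalIntegrable (fun ξ : ℝ => (t - ξ) ^ (-θ)) volume a b :=
    intervalIntegrable_sub_rpow_neg hθ
  have hpk : IntervalIntegrable (fun ξ => p ξ * (t - ξ) ^ (-θ)) volume a b :=
    hk.continuousOn_mul (by rwa [uIcc_of_le hab])
  rw [← integral_sub_rpow_neg hθ, ← intervalIntegral.integral_const_mul,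
    ← intervalIntegral.integral_const_mul, ← intervalIntegral.integral_sub hpk (hk.const_mul D)]
  rw [← Real.norm_eq_abs]
  refine intervalIntegral.norm_integral_le_of_norm_le hab
    (Eventually.of_forall fun ξ hξ => ?_) (hk.const_mul E)
  have h0 : 0 ≤ (t - ξ) ^ (-θ) := Real.rpow_nonneg (by linarith [hξ.2]) _
  rw [← sub_mul, Real.norm_eq_abs, abs_mul, abs_of_nonneg h0]
  exact mul_le_mul_of_nonneg_right (hE ξ (Ioc_subset_Icc_self hξ)) h0

/-- Piecewise linear interpolation approximates the Caputo derivative to first order. -/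
theorem abs_caputo_sub_interpolation_le {θ τ : ℝ} (hT : 0 < T) (hθ : θ < 1)
    (hw : ContDiffOn ℝ 2 w (Icc 0 T))
    (hM : ∀ t ∈ Icc 0 T, |iteratedDerivWithin 2 w (Icc 0 T) t| ≤ M) (hτ : 0 < τ) {m : ℕ}
    (hmT : ((m : ℝ) + 1) * τ ≤ T) :
    |caputoTime T θ w (((m : ℝ) + 1) * τ) - τ ^ (-θ) * ∑ j ∈ Finset.range (m + 1),
        ((((j : ℝ) + 1) ^ (1 - θ) - (j : ℝ) ^ (1 - θ)) / Real.Gamma (2 - θ)) *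
          (w (((m + 1 - j : ℕ) : ℝ) * τ) - w (((m - j : ℕ) : ℝ) * τ))|
      ≤ τ ^ (-θ) * (M * τ ^ 2 * (((m : ℝ) + 1) ^ (1 - θ) / Real.Gamma (2 - θ))) := by
  have hd : 0 < 1 - θ := by linarith
  have hGd := Real.Gamma_pos_of_pos hd
  have hG2 : Real.Gamma (2 - θ) = (1 - θ) * Real.Gamma (1 - θ) := by
    rw [← Real.Gamma_add_one hd.ne']; congr 1; ring
  set p := derivWithin w (Icc 0 T) with hp
  set t := ((m : ℝ) + 1) * τ with ht
  have ht0 : 0 ≤ t := by positivity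
  have hpc : ContinuousOn p (Icc 0 T) :=
    (hw.derivWithin (uniqueDiffOn_Icc hT) (m := 1) (by norm_num)).continuousOn
  -- The index `j` of `c` and `D` counts intervals backwards from `t`, so it belongs to the piece `J
  -- (m - j)`.
  set J : ℕ → ℝ := fun i => ∫ ξ in ((i : ℝ) * τ)..(((i + 1 : ℕ) : ℝ) * τ), p ξ * (t - ξ) ^ (-θ)
  set c : ℕ → ℝ := fun j => (((j : ℝ) + 1) ^ (1 - θ) - (j : ℝ) ^ (1 - θ)) with hc
  set D : ℕ → ℝ := fun j => w (((m + 1 - j : ℕ) : ℝ) * τ) - w (((m - j : ℕ) : ℝ) * τ) with hD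
  have hcap : caputoTime T θ w t = 1 / Real.Gamma (1 - θ) * ∑ j ∈ Finset.range (m + 1), J (m - j) := by
    rw [caputoTime, if_neg hθ.ne]
    congr 1
    have e1 : ∫ ξ in (0 : ℝ)..t, p ξ / (t - ξ) ^ θ = ∫ ξ in (0 : ℝ)..t, p ξ * (t - ξ) ^ (-θ) := by
      refine intervalIntegral.integral_congr fun ξ hξ => ?_
      rw [uIcc_of_le ht0] at hξ
      rw [Real.rpow_neg (by linarith [hξ.2]), div_eq_mul_inv]
    have hall : IntervalIntegrable (fun ξ => p ξ * (t - ξ) ^ (-θ)) volume 0 t :=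
      (intervalIntegrable_sub_rpow_neg hθ).continuousOn_mul
        (by rw [uIcc_of_le ht0]; exact hpc.mono (Icc_subset_Icc_right hmT))
    have e2 := intervalIntegral.sum_integral_adjacent_intervals (μ := volume)
      (f := fun ξ => p ξ * (t - ξ) ^ (-θ)) (a := fun i : ℕ => (i : ℝ) * τ) (n := m + 1)
      (fun k hk => hall.mono_set (by
        have hk' : ((k + 1 : ℕ) : ℝ) ≤ (m : ℝ) + 1 := by exact_mod_cast hk
        rw [uIcc_of_le ht0, uIcc_of_le (by gcongr; simp)]
        exact Icc_subset_Icc (by positivity) (mul_le_mul_of_nonneg_right hk' hτ.le)))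
    have e3 : ∑ j ∈ Finset.range (m + 1), J (m - j) = ∑ i ∈ Finset.range (m + 1), J i := by
      simpa using Finset.sum_range_reflect J (m + 1)
    rw [e1, e3]
    simp only [Nat.cast_zero, zero_mul] at e2
    rw [show ((m + 1 : ℕ) : ℝ) * τ = t by rw [ht]; push_cast; ring] at e2
    exact e2.symm
  have hpow : τ ^ (-θ) * τ = τ ^ (1 - θ) := by
    rw [← Real.rpow_add_one hτ.ne']; congr 1; ring
  have hpiece : ∀ j ∈ Finset.range (m + 1),
      |J (m - j) - D j / τ * (τ ^ (1 - θ) * c j / (1 - θ))|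
        ≤ M * τ * (τ ^ (1 - θ) * c j / (1 - θ)) := by
    intro j hj
    have hjm : j ≤ m := Nat.lt_succ_iff.1 (Finset.mem_range.1 hj)
    have hj0 : (0 : ℝ) ≤ j := j.cast_nonneg
    have hcast : ((m - j : ℕ) : ℝ) = (m : ℝ) - j := by push_cast [hjm]; ring
    have hcast1 : ((m - j + 1 : ℕ) : ℝ) = (m : ℝ) - j + 1 := by push_cast [hjm]; ring
    have hcast2 : ((m + 1 - j : ℕ) : ℝ) = (m : ℝ) - j + 1 := by
      rw [← hcast1]; congr 1; omega
    have hjm' : (j : ℝ) ≤ m := by exact_mod_cast hjm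
    set a' := ((m - j : ℕ) : ℝ) * τ with ha'
    set b' := ((m - j + 1 : ℕ) : ℝ) * τ with hb'
    have hab : b' - a' = τ := by rw [ha', hb', hcast, hcast1]; ring
    have hbt : b' ≤ t := by rw [hb', ht, hcast1]; gcongr; linarith
    have ha0 : 0 ≤ a' := by positivity
    have hta : t - a' = ((j : ℝ) + 1) * τ := by rw [ha', ht, hcast]; ring
    have htb : t - b' = (j : ℝ) * τ := by rw [hb', ht, hcast1]; ring
    have hDj : D j = w b' - w a' := by
      simp only [hD, ha', hb', hcast1, hcast2]
    -- On each interval the derivative differs from the difference quotient `D j / τ` by at most `M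
    -- τ`; the singular kernel is integrated exactly.
    have := abs_integral_mul_rpow_sub_le (θ := θ) (a := a') (b := b') (t := t) (D := D j / τ)
      (E := M * τ) (p := p) hθ (by linarith) hbt
      (hpc.mono (Icc_subset_Icc ha0 (hbt.trans hmT))) (fun ξ hξ => by
        have h := abs_sub_sub_derivWithin_mul_le hT hw hM ha0 (hbt.trans hmT) hξ
        rw [← hDj, hab] at h
        have e : p ξ - D j / τ = -(D j - p ξ * τ) / τ := by field_simp; ring
        rw [e, abs_div, abs_neg, abs_of_pos hτ, div_le_iff₀ hτ]
        linarith)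
    rw [hta, htb, Real.mul_rpow (by positivity) hτ.le, Real.mul_rpow hj0 hτ.le, ← sub_mul,
      mul_comm _ (τ ^ (1 - θ))] at this
    exact this
  have hsumc : ∑ j ∈ Finset.range (m + 1), c j = ((m : ℝ) + 1) ^ (1 - θ) := by
    have := Finset.sum_range_sub (fun j : ℕ => (j : ℝ) ^ (1 - θ)) (m + 1)
    simp only [Nat.cast_zero, Real.zero_rpow hd.ne', sub_zero] at this
    push_cast at this
    exact this
  have hdiff : caputoTime T θ w t - τ ^ (-θ) * ∑ j ∈ Finset.range (m + 1),
      (c j / Real.Gamma (2 - θ)) * D j = 1 / Real.Gamma (1 - θ) *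
        ∑ j ∈ Finset.range (m + 1), (J (m - j) - D j / τ * (τ ^ (1 - θ) * c j / (1 - θ))) := by
    rw [hcap, Finset.sum_sub_distrib, mul_sub, Finset.mul_sum _ _ (τ ^ (-θ)),
      Finset.mul_sum (Finset.range (m + 1)) (fun j => D j / τ * (τ ^ (1 - θ) * c j / (1 - θ)))]
    congr 1
    refine Finset.sum_congr rfl fun j _ => ?_
    rw [hG2, ← hpow]
    field_simp
  rw [hdiff, abs_mul, abs_of_pos (one_div_pos.2 hGd)]
  calc _ ≤ 1 / Real.Gamma (1 - θ) * ∑ j ∈ Finset.range (m + 1),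
        M * τ * (τ ^ (1 - θ) * c j / (1 - θ)) := by
        refine mul_le_mul_of_nonneg_left ?_ (one_div_pos.2 hGd).le
        exact (Finset.abs_sum_le_sum_abs _ _).trans (Finset.sum_le_sum hpiece)
    _ = _ := by
        rw [← Finset.mul_sum, ← Finset.sum_div, ← Finset.mul_sum, hsumc, hG2, ← hpow]
        field_simp

/-- The truncation error of the Grünwald approximation of the Caputo derivative. -/
theorem abs_gl_sub_caputo_le {θ τ P : ℝ} (hT : 0 < T) (h0 : 0 < θ) (h1 : θ ≤ 1)
    (hw : ContDiffOn ℝ 2 w (Icc 0 T))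
    (hM : ∀ t ∈ Icc 0 T, |iteratedDerivWithin 2 w (Icc 0 T) t| ≤ M)
    (hP : |derivWithin w (Icc 0 T) 0| ≤ P) (hτ : 0 < τ) {n : ℕ} (hn : 1 ≤ n)
    (hnT : (n : ℝ) * τ ≤ T) :
    |τ ^ (-θ) * ∑ k ∈ Finset.range n, glCoeff θ k * (w (((n - k : ℕ) : ℝ) * τ) - w 0)
        - caputoTime T θ w (n * τ)|
      ≤ τ * (P + 2 * M * T + 3 * M) *
        (τ ^ (-θ) * ∑ k ∈ Finset.range n, glCoeff θ k * (1 + ((n - k : ℕ) : ℝ) * τ)) := by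
  obtain ⟨m, rfl⟩ : ∃ m, n = m + 1 := ⟨n - 1, by omega⟩
  have hM0 : 0 ≤ M := (abs_nonneg _).trans (hM 0 ⟨le_rfl, hT.le⟩)
  have hP0 : 0 ≤ P := (abs_nonneg _).trans hP
  have hpτ : 0 < τ ^ (-θ) := Real.rpow_pos_of_pos hτ _
  have hcastn : ((m + 1 : ℕ) : ℝ) = (m : ℝ) + 1 := by push_cast; ring
  have hmτ : 0 ≤ (m : ℝ) * τ := by positivity
  rw [hcastn] at hnT ⊢
  have hτT : τ ≤ T := by linarith
  rw [sum_glCoeff_mul_one_add]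
  set S := ∑ j ∈ Finset.range (m + 1), glPartial θ j with hS
  set b := glPartial θ m with hb
  have hb0 : 0 ≤ b := glPartial_nonneg h1 m
  set D : ℕ → ℝ := fun j => w (((m + 1 - j : ℕ) : ℝ) * τ) - w (((m - j : ℕ) : ℝ) * τ) with hD
  have hgl : ∑ k ∈ Finset.range (m + 1), glCoeff θ k * (w (((m + 1 - k : ℕ) : ℝ) * τ) - w 0)
      = ∑ j ∈ Finset.range (m + 1), glPartial θ j * D j := by
    have := sum_glCoeff_mul θ (fun i => w ((i : ℝ) * τ)) (m + 1)
    simpa [hD] using this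
  rw [hgl]
  have hDτ : ∀ j ≤ m, ∀ z ∈ Icc (((m - j : ℕ) : ℝ) * τ) (((m + 1 - j : ℕ) : ℝ) * τ),
      |D j - derivWithin w (Icc 0 T) z * τ| ≤ M * τ ^ 2 := by
    intro j hj z hz
    have hc : ((m + 1 - j : ℕ) : ℝ) = ((m - j : ℕ) : ℝ) + 1 := by
      rw [← Nat.cast_succ]; congr 1; omega
    have hc2 : ((m + 1 - j : ℕ) : ℝ) ≤ (m : ℝ) + 1 := by
      rw [← Nat.cast_succ]; exact Nat.cast_le.2 (by omega)
    have := abs_sub_sub_derivWithin_mul_le hT hw hM (by positivity)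
      ((mul_le_mul_of_nonneg_right hc2 hτ.le).trans hnT) hz
    rwa [show ((m + 1 - j : ℕ) : ℝ) * τ - ((m - j : ℕ) : ℝ) * τ = τ by rw [hc]; ring] at this
  rcases eq_or_lt_of_le h1 with rfl | hlt
  -- For `θ = 1` only `b_0 = 1` is nonzero and the formula is the backward difference. The barrier
  -- is then used only through `τ ≤ τ S`.
  · have hS1 : 1 ≤ S := by
      refine (glPartial_zero 1).symm.le.trans ?_
      exact Finset.single_le_sum (f := glPartial 1) (fun j _ => glPartial_nonneg le_rfl j)
        (Finset.mem_range.2 (Nat.succ_pos m))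
    have hzero : ∀ j, glPartial 1 (j + 1) = 0 := by
      intro j
      induction j with
      | zero => have := succ_mul_glPartial_succ 1 0; simpa using this
      | succ j ih =>
        have := succ_mul_glPartial_succ 1 (j + 1)
        rw [ih, mul_zero] at this
        exact (mul_eq_zero.1 this).resolve_left (by positivity)
    have hsum : ∑ j ∈ Finset.range (m + 1), glPartial 1 j * D j = D 0 := by
      rw [Finset.sum_range_succ']
      simp [hzero, glPartial_zero]
    rw [hsum, caputoTime, if_pos rfl, Real.rpow_neg_one]
    have hz := hDτ 0 (Nat.zero_le _) (((m : ℝ) + 1) * τ)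
      ⟨by gcongr; simp, by simp⟩
    have e : τ⁻¹ * D 0 - derivWithin w (Icc 0 T) (((m : ℝ) + 1) * τ)
        = τ⁻¹ * (D 0 - derivWithin w (Icc 0 T) (((m : ℝ) + 1) * τ) * τ) := by field_simp
    rw [e, abs_mul, abs_of_pos (inv_pos.2 hτ)]
    have e2 : τ * (P + 2 * M * T + 3 * M) * (τ⁻¹ * (b + τ * S)) = τ⁻¹ *
      (τ * (P + 2 * M * T + 3 * M) * (b + τ * S)) := by ring
    rw [e2]
    refine mul_le_mul_of_nonneg_left (hz.trans ?_) (inv_pos.2 hτ).le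
    have hMT : 0 ≤ M * T := by positivity
    calc M * τ ^ 2 = τ * M * (τ * 1) := by ring
      _ ≤ τ * (P + 2 * M * T + 3 * M) * (b + τ * S) := by
        have : τ * 1 ≤ b + τ * S := by nlinarith
        gcongr
        linarith
  · have hL := abs_caputo_sub_interpolation_le hT hlt hw hM hτ hnT
    -- `B j` is the accumulated difference between the Grünwald weights and those of linear
    -- interpolation. It is bounded by one weight `b_{j-1}`, which makes summation by parts
    -- worthwhile.
    set B : ℕ → ℝ := fun j => ∑ i ∈ Finset.range j, glPartial θ i
      - (j : ℝ) ^ (1 - θ) / Real.Gamma (2 - θ) with hBdef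
    have hd : 1 - θ ≠ 0 := by linarith
    have hB0 : B 0 = 0 := by simp [hBdef, Real.zero_rpow hd]
    have hBle : ∀ j, |B (j + 1)| ≤ glPartial θ j := by
      intro j
      have := abs_sum_glPartial_sub_le h0 hlt j
      simpa [hBdef] using this
    have hparts := sum_sub_mul_by_parts B D hB0 m
    have hBdiff : ∀ j, B (j + 1) - B j = glPartial θ j
        - (((j : ℝ) + 1) ^ (1 - θ) - (j : ℝ) ^ (1 - θ)) / Real.Gamma (2 - θ) := by
      intro j
      simp only [hBdef, Finset.sum_range_succ]
      push_cast
      ring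
    -- `D m = w τ - w 0` is the first increment. Only here does the initial velocity enter,
    -- multiplied by the last weight `b`.
    have hDm : |D m| ≤ τ * P + M * τ ^ 2 := by
      have h := hDτ m le_rfl 0 ⟨by simp, by positivity⟩
      have h2 := abs_sub_abs_le_abs_sub (D m) (derivWithin w (Icc 0 T) 0 * τ)
      rw [abs_mul, abs_of_pos hτ] at h2
      nlinarith
    -- Neighbouring increments share the node `(m - j) τ`; both are compared with the derivative
    -- there.
    have hDD : ∀ j ∈ Finset.range m, |D (j + 1) - D j| ≤ 2 * (M * τ ^ 2) := by
      intro j hj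
      have hj' := Finset.mem_range.1 hj
      have a1 := hDτ (j + 1) (by omega) (((m - j : ℕ) : ℝ) * τ)
        ⟨mul_le_mul_of_nonneg_right (Nat.cast_le.2 (by omega)) hτ.le,
          mul_le_mul_of_nonneg_right (Nat.cast_le.2 (by omega)) hτ.le⟩
      have a2 := hDτ j (by omega) (((m - j : ℕ) : ℝ) * τ) 
        ⟨le_rfl, mul_le_mul_of_nonneg_right (Nat.cast_le.2 (by omega)) hτ.le⟩
      rw [abs_le] at a1 a2 ⊢
      constructor <;> linarith [a1.1, a1.2, a2.1, a2.2]
    have hsum : |∑ j ∈ Finset.range (m + 1), (B (j + 1) - B j) * D j|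
        ≤ b * (τ * P + M * τ ^ 2) + 2 * (M * τ ^ 2) * S := by
      rw [hparts]
      refine (abs_sub _ _).trans (add_le_add ?_ ?_)
      · rw [abs_mul]
        exact mul_le_mul (hBle m) hDm (abs_nonneg _) hb0
      · refine (Finset.abs_sum_le_sum_abs _ _).trans ?_
        calc ∑ j ∈ Finset.range m, |B (j + 1) * (D (j + 1) - D j)|
            ≤ ∑ j ∈ Finset.range m, glPartial θ j * (2 * (M * τ ^ 2)) := by
              refine Finset.sum_le_sum fun j hj => ?_
              rw [abs_mul]
              exact mul_le_mul (hBle j) (hDD j hj) (abs_nonneg _) (glPartial_nonneg h1 j)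
          _ = 2 * (M * τ ^ 2) * ∑ j ∈ Finset.range m, glPartial θ j := by
              rw [← Finset.sum_mul, mul_comm]
          _ ≤ 2 * (M * τ ^ 2) * S := by
              rw [hS, Finset.sum_range_succ]
              exact mul_le_mul_of_nonneg_left (by linarith) (by positivity)
    have hpow : ((m : ℝ) + 1) ^ (1 - θ) / Real.Gamma (2 - θ) ≤ S + b := by
      have := (abs_le.1 (abs_sum_glPartial_sub_le h0 hlt m)).1
      linarith
    have hsplit : τ ^ (-θ) * ∑ j ∈ Finset.range (m + 1), glPartial θ j * D j
        - caputoTime T θ w (((m : ℝ) + 1) * τ)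
        = τ ^ (-θ) * ∑ j ∈ Finset.range (m + 1), (B (j + 1) - B j) * D j
          - (caputoTime T θ w (((m : ℝ) + 1) * τ) - τ ^ (-θ) * ∑ j ∈ Finset.range (m + 1),
            ((((j : ℝ) + 1) ^ (1 - θ) - (j : ℝ) ^ (1 - θ)) / Real.Gamma (2 - θ)) * D j) := by
      simp only [hBdiff, sub_mul, Finset.sum_sub_distrib]
      ring
    rw [hsplit]
    refine (abs_sub _ _).trans ((add_le_add (le_of_eq (abs_mul _ _)) hL).trans ?_)
    rw [abs_of_pos hpτ, ← mul_add]
    -- The three terms are the boundary term of the summation by parts, its sum of second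
    -- differences, and the interpolation error. The coefficient of `b` is `P + 2 M τ` and that of
    -- `τ S` is `3 M`; with `τ ≤ T` both are at most `P + 2 M T + 3 M`.
    calc _ ≤ τ ^ (-θ) * (b * (τ * P + M * τ ^ 2) + 2 * (M * τ ^ 2) * S
          + M * τ ^ 2 * (S + b)) := by gcongr
      _ = τ ^ (-θ) * (τ * ((P + M * τ + M * τ) * b + 3 * M * (τ * S))) := by ring
      _ ≤ τ ^ (-θ) * (τ * ((P + 2 * M * T + 3 * M) * b + (P + 2 * M * T + 3 * M) * (τ * S))) := by
        have hS0 : 0 ≤ S := Finset.sum_nonneg fun j _ => glPartial_nonneg h1 j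
        have hMτ : M * τ ≤ M * T := mul_le_mul_of_nonneg_left hτT hM0
        have hMT : 0 ≤ M * T := by positivity
        have hb1 : (P + M * τ + M * τ) * b ≤ (P + 2 * M * T + 3 * M) * b :=
          mul_le_mul_of_nonneg_right (by linarith) hb0
        have hS1 : 3 * M * (τ * S) ≤ (P + 2 * M * T + 3 * M) * (τ * S) :=
          mul_le_mul_of_nonneg_right (by linarith) (by positivity)
        exact mul_le_mul_of_nonneg_left
          (mul_le_mul_of_nonneg_left (add_le_add hb1 hS1) hτ.le) hpτ.le
      _ = _ := by ring

end Time

/-! ### The discrete energy argument -/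

section Energy

variable {X : Type*} [MeasurableSpace X] {μ : Measure X}

theorem integral_mul_le_sqrt_mul_sqrt {f g : X → ℝ} (hf : MemLp f 2 μ) (hg : MemLp g 2 μ) :
    ∫ x, f x * g x ∂μ ≤ Real.sqrt (∫ x, f x ^ 2 ∂μ) * Real.sqrt (∫ x, g x ^ 2 ∂μ) := by
  have hff := hf.integrable_sq
  have hgg := hg.integrable_sq
  have hfg : Integrable (fun x => f x * g x) μ := hf.integrable_mul hg
  have hA : 0 ≤ ∫ x, f x ^ 2 ∂μ := integral_nonneg fun x => sq_nonneg _
  have hq : ∀ t : ℝ, 0 ≤ (∫ x, f x ^ 2 ∂μ) * (t * t) + (2 * ∫ x, f x * g x ∂μ) * t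
      + ∫ x, g x ^ 2 ∂μ := by
    intro t
    have h0 : 0 ≤ ∫ x, (t * f x + g x) ^ 2 ∂μ := integral_nonneg fun x => sq_nonneg _
    have e : ∀ x, (t * f x + g x) ^ 2 = t * t * f x ^ 2 + 2 * t * (f x * g x) + g x ^ 2 :=
      fun x => by ring
    simp only [e] at h0
    have hsum : Integrable (fun x => t * t * f x ^ 2 + 2 * t * (f x * g x)) μ :=
      (hff.const_mul _).add (hfg.const_mul _)
    rw [integral_add hsum hgg,
      integral_add (hff.const_mul _) (hfg.const_mul _), integral_const_mul, integral_const_mul] at h0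
    linarith
  have hdis := discrim_le_zero hq
  rw [discrim] at hdis
  rw [← Real.sqrt_mul hA]
  exact Real.le_sqrt_of_sq_le (by linarith)

/-- Multiplication by `e n` and integration: the term with `G` has the good sign, the history terms
have coefficients `-c k ≥ 0` and are bounded by Cauchy-Schwarz, and the residual by `ρ ∫ |e n|`. One
factor of the norm of `e n` is then cancelled. The sum stops before `k = n`, so `e 0` plays no role.
-/
theorem energy_step [IsFiniteMeasure μ] {n : ℕ} (hn : 1 ≤ n) {e : ℕ → X → ℝ}
    (he : ∀ m, 1 ≤ m → m ≤ n → MemLp (e m) 2 μ) {G : X → ℝ}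
    (hG : Integrable (fun x => e n x * G x) μ) (hG0 : ∫ x, e n x * G x ∂μ ≤ 0)
    {c : ℕ → ℝ} (hc : ∀ k, 1 ≤ k → c k ≤ 0) {ρ : ℝ} (hρ : 0 ≤ ρ)
    (h : ∀ᵐ x ∂μ, |∑ k ∈ Finset.range n, c k * e (n - k) x - G x| ≤ ρ) :
    c 0 * Real.sqrt (∫ x, e n x ^ 2 ∂μ) ≤
      ∑ k ∈ Finset.Ico 1 n, -c k * Real.sqrt (∫ x, e (n - k) x ^ 2 ∂μ)
        + ρ * Real.sqrt (μ.real univ) := by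
  set E : ℕ → ℝ := fun m => Real.sqrt (∫ x, e m x ^ 2 ∂μ) with hE
  have hE0 : ∀ m, 0 ≤ E m := fun m => Real.sqrt_nonneg _
  have hEn : ∫ x, e n x ^ 2 ∂μ = E n * E n :=
    (Real.mul_self_sqrt (integral_nonneg fun x => sq_nonneg _)).symm
  have hen := he n hn le_rfl
  have hterm : ∀ k ∈ Finset.Ico 1 n, Integrable (fun x => -c k * (e (n - k) x * e n x)) μ := by
    intro k hk
    rw [Finset.mem_Ico] at hk
    have hnk : MemLp (e (n - k)) 2 μ := he (n - k) (by omega) (by omega)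
    have : Integrable (fun x => e (n - k) x * e n x) μ := hnk.integrable_mul hen
    exact this.const_mul _
  have habs : Integrable (fun x => ρ * |e n x|) μ := (hen.integrable one_le_two).abs.const_mul ρ
  have hpt : ∀ᵐ x ∂μ, c 0 * e n x ^ 2 ≤
      ∑ k ∈ Finset.Ico 1 n, -c k * (e (n - k) x * e n x) + e n x * G x + ρ * |e n x| := by
    filter_upwards [h] with x hx
    have h1 : (∑ k ∈ Finset.range n, c k * e (n - k) x - G x) * e n x ≤ ρ * |e n x| :=
      (le_abs_self _).trans (by rw [abs_mul]; gcongr)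
    rw [Finset.range_eq_Ico, Finset.sum_eq_sum_Ico_succ_bot (by omega)] at h1
    simp only [Nat.sub_zero, zero_add] at h1
    have h2 : ∑ k ∈ Finset.Ico 1 n, -c k * (e (n - k) x * e n x)
        = -((∑ k ∈ Finset.Ico 1 n, c k * e (n - k) x) * e n x) := by
      rw [Finset.sum_mul, ← Finset.sum_neg_distrib]
      exact Finset.sum_congr rfl fun k _ => by ring
    rw [h2]
    nlinarith
  have hint := integral_mono_ae (hen.integrable_sq.const_mul (c 0))
    (((integrable_finsetSum _ hterm).add hG).add habs) hpt
  have hs := integral_add ((integrable_finsetSum _ hterm).add hG) habs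
  have hs2 := integral_add (integrable_finsetSum _ hterm) hG
  simp only [Pi.add_apply] at hs hs2 hint
  rw [hs, hs2, integral_finsetSum _ hterm] at hint
  simp only [integral_const_mul] at hint
  rw [hEn] at hint
  have hcs : ∑ k ∈ Finset.Ico 1 n, -c k * ∫ x, e (n - k) x * e n x ∂μ
      ≤ (∑ k ∈ Finset.Ico 1 n, -c k * E (n - k)) * E n := by
    rw [Finset.sum_mul]
    refine Finset.sum_le_sum fun k hk => ?_
    rw [Finset.mem_Ico] at hk
    rw [mul_assoc]
    exact mul_le_mul_of_nonneg_left
      (integral_mul_le_sqrt_mul_sqrt (he _ (by omega) (by omega)) hen)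
      (neg_nonneg.2 (hc k hk.1))
  have habs' : ∫ x, |e n x| ∂μ ≤ Real.sqrt (μ.real univ) * E n := by
    have := integral_mul_le_sqrt_mul_sqrt (μ := μ) (memLp_const (1 : ℝ)) hen.abs
    simpa [hE] using this
  have hfin : c 0 * (E n * E n)
      ≤ (∑ k ∈ Finset.Ico 1 n, -c k * E (n - k) + ρ * Real.sqrt (μ.real univ)) * E n := by
    have := mul_le_mul_of_nonneg_left habs' hρ
    nlinarith
  change c 0 * E n ≤ ∑ k ∈ Finset.Ico 1 n, -c k * E (n - k) + ρ * Real.sqrt (μ.real univ)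
  rcases eq_or_lt_of_le (hE0 n) with h0 | hpos
  · rw [← h0, mul_zero]
    refine add_nonneg (Finset.sum_nonneg fun k hk => ?_) (mul_nonneg hρ (Real.sqrt_nonneg _))
    exact mul_nonneg (neg_nonneg.2 (hc k (Finset.mem_Ico.1 hk).1)) (hE0 _)
  · refine le_of_mul_le_mul_right ?_ hpos
    linarith

end Energy

/-- The discrete comparison principle for convolution operators with nonpositive off-diagonal
coefficients. -/
theorem discrete_comparison {c E y : ℕ → ℝ} {N : ℕ} (hc0 : 0 < c 0) (hc : ∀ k, 1 ≤ k → c k ≤ 0)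
    (h : ∀ n, 1 ≤ n → n ≤ N → c 0 * E n ≤
      ∑ k ∈ Finset.Ico 1 n, -c k * E (n - k) + ∑ k ∈ Finset.range n, c k * y (n - k)) :
    ∀ n, 1 ≤ n → n ≤ N → E n ≤ y n := by
  intro n
  induction n using Nat.strong_induction_on with
  | _ n ih =>
    intro hn hnN
    have h1 := h n hn hnN
    have h2 : ∑ k ∈ Finset.Ico 1 n, -c k * E (n - k) ≤ ∑ k ∈ Finset.Ico 1 n, -c k * y (n - k) := by
      refine Finset.sum_le_sum fun k hk => ?_
      rw [Finset.mem_Ico] at hk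
      exact mul_le_mul_of_nonneg_left (ih _ (by omega) (by omega) (by omega))
        (neg_nonneg.2 (hc k hk.1))
    rw [Finset.range_eq_Ico, Finset.sum_eq_sum_Ico_succ_bot (show 0 < n by omega)] at h1
    simp only [Nat.sub_zero, zero_add] at h1
    have h3 : ∑ k ∈ Finset.Ico 1 n, -c k * y (n - k) = -∑ k ∈ Finset.Ico 1 n, c k * y (n - k) := by
      rw [← Finset.sum_neg_distrib]
      exact Finset.sum_congr rfl fun k _ => by ring
    refine le_of_mul_le_mul_left ?_ hc0
    linarith

/-! ### The error equation -/

section Main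

variable {d s : ℕ} {Ω : Set (Fin d → ℝ)} {T : ℝ} {θ a : Fin s → ℝ} {α εp εm : Fin d → ℝ}
  {f g : ℝ → (Fin d → ℝ) → ℝ} {u₀ : (Fin d → ℝ) → ℝ} {u : ℝ → (Fin d → ℝ) → ℝ}

/-- The initial velocity is bounded. -/
theorem exists_initial_velocity_bound (hb : Bornology.IsBounded Ω) (hT : 0 < T)
    (hu : IsExactSolution Ω T a θ α εp εm f g u₀ u)
    (hu_time : ∀ x ∈ Ω, ContDiffOn ℝ 2 (fun t => u t x) (Icc 0 T)) {M : ℝ}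
    (hM : ∀ x ∈ Ω, ∀ t ∈ Icc 0 T,
      |iteratedDerivWithin 2 (fun t' => u t' x) (Icc 0 T) t| ≤ M) :
    ∃ P, 0 ≤ P ∧ ∀ x ∈ Ω, |derivWithin (fun t => u t x) (Icc 0 T) 0| ≤ P := by
  -- Boundedness of `u` in space comes from regularity, which is available only for positive times.
  -- The velocity at `T / 2` is estimated by a difference quotient over `[T / 2, T]` and carried
  -- back to time `0` by the bound on the second derivative.
  obtain ⟨B₁, hB₁⟩ := exists_abs_le_of_continuousOn_closure hb
    (hu.regular T ⟨hT, le_rfl⟩).continuousOn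
  obtain ⟨B₂, hB₂⟩ := exists_abs_le_of_continuousOn_closure hb
    (hu.regular (T / 2) ⟨by linarith, by linarith⟩).continuousOn
  refine ⟨max ((B₁ + B₂ + M * (T / 2) ^ 2) / (T / 2) + M * (T / 2)) 0, le_max_right _ _,
    fun x hx => le_max_of_le_left ?_⟩
  have h1 := abs_sub_sub_derivWithin_mul_le hT (hu_time x hx) (hM x hx) (x := T / 2) (y := T)
    (z := T / 2) (by linarith) le_rfl ⟨le_rfl, by linarith⟩
  have h2 := abs_derivWithin_sub_le hT (hu_time x hx) (hM x hx) (x := 0) (y := T / 2)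
    ⟨le_rfl, hT.le⟩ ⟨by linarith, by linarith⟩
  set p := derivWithin (fun t => u t x) (Icc 0 T)
  rw [sub_zero, abs_of_pos (half_pos hT)] at h2
  rw [show T - T / 2 = T / 2 by ring] at h1
  have h3 : |p (T / 2)| ≤ (B₁ + B₂ + M * (T / 2) ^ 2) / (T / 2) := by
    rw [le_div_iff₀ (half_pos hT), ← abs_of_pos (half_pos hT), ← abs_mul,
      abs_of_pos (half_pos hT)]
    have b1 := abs_le.1 (hB₁ x hx)
    have b2 := abs_le.1 (hB₂ x hx)
    have b3 := abs_le.1 h1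
    exact abs_le.2 ⟨by linarith [b1.1, b2.2, b3.2], by linarith [b1.2, b2.1, b3.1]⟩
  have h4 := abs_sub_abs_le_abs_sub (p 0) (p (T / 2))
  rw [abs_sub_comm] at h4
  linarith

/-- The right-hand side is the pure truncation error in time: the space operator is not discretised,
so it acts on the error itself, and the equal initial values let both Grünwald sums be written in
increments from `u 0`. -/
theorem error_equation (ho : IsOpen Ω) (hc : Convex ℝ Ω) (hb : Bornology.IsBounded Ω)
    (hT : 0 < T) (hα : ∀ l, 1 < α l ∧ α l ≤ 2)
    (hu : IsExactSolution Ω T a θ α εp εm f g u₀ u) {N : ℕ} {U : ℕ → (Fin d → ℝ) → ℝ}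
    (hU : IsSemiDiscreteSolution Ω T a θ α εp εm f g u₀ N U) {n : ℕ} (hn : 1 ≤ n) (hnN : n ≤ N)
    {x : Fin d → ℝ} (hx : x ∈ Ω) :
    ∑ k ∈ Finset.range n, (∑ r, a r / (T / N) ^ θ r * glCoeff (θ r) k) *
        (u (((n - k : ℕ) : ℝ) * (T / N)) x - U (n - k) x)
      - spaceOp Ω α εp εm (fun y => u (n * (T / N)) y - U n y) x
      = ∑ r, a r * ((T / N) ^ (-θ r) * ∑ k ∈ Finset.range n, glCoeff (θ r) k *
          (u (((n - k : ℕ) : ℝ) * (T / N)) x - u 0 x)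
        - caputoTime T (θ r) (fun t => u t x) (n * (T / N))) := by
  have hN : (0 : ℝ) < N := by exact_mod_cast hn.trans hnN
  have hτ : 0 < T / N := by positivity
  have hn0 : (0 : ℝ) < n := by exact_mod_cast hn
  have hnT : (n : ℝ) * (T / N) ≤ T := by
    rw [mul_div_assoc', div_le_iff₀ hN, mul_comm]
    exact mul_le_mul_of_nonneg_left (by exact_mod_cast hnN) hT.le
  have hmem : (n : ℝ) * (T / N) ∈ Ioc 0 T := ⟨by positivity, hnT⟩
  rw [spaceOp_sub ho hc hb hα (hu.regular _ hmem) (hU.regular n hn hnN) εp εm hx]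
  have h1 := hu.equation _ hmem x hx
  have h2 := hU.equation n hn hnN x hx
  have h0 : U 0 x = u 0 x := by rw [hU.initial x hx, hu.initial x hx]
  rw [multiTermCaputo] at h1
  have hsplit : (∑ r, a r * glCoeff (θ r) 0 / (T / N) ^ θ r) * U n x
      + ∑ r, a r / (T / N) ^ θ r * ∑ k ∈ Finset.Ico 1 n, glCoeff (θ r) k * U (n - k) x
      - ∑ r, a r / (T / N) ^ θ r * ∑ k ∈ Finset.range n, glCoeff (θ r) k * U 0 x
      = ∑ r, a r / (T / N) ^ θ r * ∑ k ∈ Finset.range n, glCoeff (θ r) k *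
        (U (n - k) x - u 0 x) := by
    rw [Finset.sum_mul, ← Finset.sum_add_distrib, ← Finset.sum_sub_distrib]
    refine Finset.sum_congr rfl fun r _ => ?_
    simp only [mul_sub, Finset.sum_sub_distrib, h0]
    have : ∑ k ∈ Finset.range n, glCoeff (θ r) k * U (n - k) x
        = glCoeff (θ r) 0 * U n x + ∑ k ∈ Finset.Ico 1 n, glCoeff (θ r) k * U (n - k) x := by
      rw [Finset.range_eq_Ico, Finset.sum_eq_sum_Ico_succ_bot (by omega)]
      simp
    rw [this]
    ring
  have hlhs : ∑ k ∈ Finset.range n, (∑ r, a r / (T / N) ^ θ r * glCoeff (θ r) k) *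
        (u (((n - k : ℕ) : ℝ) * (T / N)) x - U (n - k) x)
      = (∑ r, a r * ((T / N) ^ (-θ r) * ∑ k ∈ Finset.range n, glCoeff (θ r) k *
          (u (((n - k : ℕ) : ℝ) * (T / N)) x - u 0 x)))
        - ∑ r, a r / (T / N) ^ θ r * ∑ k ∈ Finset.range n, glCoeff (θ r) k *
          (U (n - k) x - u 0 x) := by
    simp only [Finset.sum_mul]
    rw [Finset.sum_comm, ← Finset.sum_sub_distrib]
    refine Finset.sum_congr rfl fun r _ => ?_
    rw [Real.rpow_neg hτ.le, ← mul_assoc, ← div_eq_mul_inv, ← mul_sub, ← Finset.sum_sub_distrib,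
      Finset.mul_sum]
    exact Finset.sum_congr rfl fun k _ => by ring
  simp only [mul_sub (a _)]
  rw [Finset.sum_sub_distrib]
  linarith

end Main

end TSFPDE

/-! ### The error estimate -/

theorem theorem4p2 {d s : ℕ} (Ω : Set (Fin d → ℝ)) (hΩ_open : IsOpen Ω)
    (hΩ_convex : Convex ℝ Ω) (hΩ_bounded : Bornology.IsBounded Ω)
    (T : ℝ) (hT : 0 < T) (hs : 0 < s)
    (θ : Fin s → ℝ) (hθ : ∀ r, 0 < θ r ∧ θ r ≤ 1)
    (a : Fin s → ℝ) (ha_first : 0 < a ⟨0, hs⟩) (ha : ∀ r, 0 ≤ a r)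
    (α : Fin d → ℝ) (hα : ∀ l, 1 < α l ∧ α l ≤ 2)
    (εp εm : Fin d → ℝ) (hεp : ∀ l, 0 ≤ εp l) (hεm : ∀ l, 0 ≤ εm l)
    (f g : ℝ → (Fin d → ℝ) → ℝ) (u₀ : (Fin d → ℝ) → ℝ) (u : ℝ → (Fin d → ℝ) → ℝ)
    (hu : TSFPDE.IsExactSolution Ω T a θ α εp εm f g u₀ u)
    (hu_grad : ∀ t ∈ Set.Ioc 0 T, TSFPDE.GradZeroOnBoundary Ω (u t))
    (hu_time : ∀ x ∈ Ω, ContDiffOn ℝ 2 (fun t => u t x) (Set.Icc 0 T))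
    (hu_bound : ∃ M : ℝ, ∀ x ∈ Ω, ∀ t ∈ Set.Icc 0 T,
      |iteratedDerivWithin 2 (fun t' => u t' x) (Set.Icc 0 T) t| ≤ M) :
    ∃ C : ℝ, ∀ N : ℕ, 0 < N → ∀ U : ℕ → (Fin d → ℝ) → ℝ,
      TSFPDE.IsSemiDiscreteSolution Ω T a θ α εp εm f g u₀ N U →
      (∀ n, 1 ≤ n → n ≤ N → ∀ l, α l < 2 → TSFPDE.PartialZeroOnBoundary Ω l (U n)) →
      ∀ n, 1 ≤ n → n ≤ N →
        TSFPDE.l2Norm Ω (fun x => u (n * (T / N)) x - U n x) ≤ C * (T / N) := by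

  obtain ⟨M', hM'⟩ := hu_bound
  -- The given bound may be negative when `Ω` is empty.
  set M := max M' 0 with hMdef
  have hM0 : 0 ≤ M := le_max_right _ _
  have hM : ∀ x ∈ Ω, ∀ t ∈ Set.Icc 0 T,
      |iteratedDerivWithin 2 (fun t' => u t' x) (Set.Icc 0 T) t| ≤ M := fun x hx t ht =>
    (hM' x hx t ht).trans (le_max_left _ _)
  obtain ⟨P, hP0, hP⟩ := TSFPDE.exists_initial_velocity_bound hΩ_bounded hT hu hu_time hM
  set K := P + 2 * M * T + 3 * M with hK
  have hK0 : 0 ≤ K := by positivity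
  set V := Real.sqrt ((MeasureTheory.volume.restrict Ω).real Set.univ) with hV
  have hV0 : 0 ≤ V := Real.sqrt_nonneg _
  -- `V = |Ω|^{1/2}` converts a pointwise residual into an `L²` bound, `K` is the truncation
  -- constant, and `1 + T` bounds the barrier `1 + t`.
  refine ⟨V * K * (1 + T), fun N hN U hU hU_grad => ?_⟩
  have hfin := TSFPDE.isFiniteMeasure_restrict_of_isBounded hΩ_bounded
  have hNpos : (0 : ℝ) < N := by exact_mod_cast hN
  set τ := T / N with hτdef
  have hτ : 0 < τ := by positivity
  have hnT : ∀ n : ℕ, n ≤ N → (n : ℝ) * τ ≤ T := by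
    intro n hn
    rw [hτdef, mul_div_assoc', div_le_iff₀ hNpos, mul_comm]
    exact mul_le_mul_of_nonneg_left (by exact_mod_cast hn) hT.le
  have hmem : ∀ n : ℕ, 1 ≤ n → n ≤ N → (n : ℝ) * τ ∈ Set.Ioc 0 T := by
    intro n hn hnN
    have : (0 : ℝ) < n := by exact_mod_cast hn
    exact ⟨by positivity, hnT n hnN⟩
  set e : ℕ → (Fin d → ℝ) → ℝ := fun n x => u (n * τ) x - U n x with he
  have hreg : ∀ n, 1 ≤ n → n ≤ N → TSFPDE.SpaceRegular Ω α (e n) := fun n hn hnN =>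
    (hu.regular _ (hmem n hn hnN)).sub hΩ_open hΩ_convex hΩ_bounded hα (hU.regular n hn hnN)
  have hLp : ∀ n, 1 ≤ n → n ≤ N →
      MeasureTheory.MemLp (e n) 2 (MeasureTheory.volume.restrict Ω) := by
    intro n hn hnN
    have hcont := (hreg n hn hnN).continuousOn
    obtain ⟨B, hB⟩ := TSFPDE.exists_abs_le_of_continuousOn_closure hΩ_bounded hcont
    refine MeasureTheory.MemLp.of_bound
      ((hcont.mono subset_closure).aestronglyMeasurable hΩ_open.measurableSet) B ?_
    filter_upwards [MeasureTheory.ae_restrict_mem hΩ_open.measurableSet] with x hx using hB x hx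
  set c : ℕ → ℝ := fun k => ∑ r, a r / τ ^ θ r * TSFPDE.glCoeff (θ r) k with hc
  have hw0 : ∀ r, 0 ≤ a r / τ ^ θ r := fun r => div_nonneg (ha r) (Real.rpow_nonneg hτ.le _)
  have hc0 : 0 < c 0 := by
    simp only [hc, TSFPDE.glCoeff, mul_one]
    exact Finset.sum_pos' (fun r _ => hw0 r)
      ⟨⟨0, hs⟩, Finset.mem_univ _, div_pos ha_first (Real.rpow_pos_of_pos hτ _)⟩
  have hcneg : ∀ k, 1 ≤ k → c k ≤ 0 := by
    intro k hk
    obtain ⟨j, rfl⟩ : ∃ j, k = j + 1 := ⟨k - 1, by omega⟩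
    exact Finset.sum_nonpos fun r _ => mul_nonpos_of_nonneg_of_nonpos (hw0 r)
      (TSFPDE.glCoeff_succ_nonpos (hθ r).1.le (hθ r).2 j)
  have hconv : ∀ n : ℕ, ∑ k ∈ Finset.range n, c k * (1 + ((n - k : ℕ) : ℝ) * τ)
      = ∑ r, a r * (τ ^ (-θ r) * ∑ k ∈ Finset.range n, TSFPDE.glCoeff (θ r) k *
        (1 + ((n - k : ℕ) : ℝ) * τ)) := by
    intro n
    simp only [hc, Finset.sum_mul]
    rw [Finset.sum_comm]
    refine Finset.sum_congr rfl fun r _ => ?_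
    rw [Real.rpow_neg hτ.le, ← mul_assoc, ← div_eq_mul_inv, Finset.mul_sum]
    exact Finset.sum_congr rfl fun k _ => by ring
  have hconv0 : ∀ n : ℕ, 1 ≤ n →
      0 ≤ ∑ k ∈ Finset.range n, c k * (1 + ((n - k : ℕ) : ℝ) * τ) := by
    intro n hn
    obtain ⟨m, rfl⟩ : ∃ m, n = m + 1 := ⟨n - 1, by omega⟩
    rw [hconv]
    refine Finset.sum_nonneg fun r _ => mul_nonneg (ha r)
      (mul_nonneg (Real.rpow_nonneg hτ.le _) ?_)
    rw [TSFPDE.sum_glCoeff_mul_one_add]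
    exact add_nonneg (TSFPDE.glPartial_nonneg (hθ r).2 m) (mul_nonneg hτ.le
      (Finset.sum_nonneg fun j _ => TSFPDE.glPartial_nonneg (hθ r).2 j))
  -- The barrier is `V τ K (1 + t)`. The residual bound `ρ` is `τ K` times the discrete operator
  -- applied to `1 + t`, so `ρ V` is exactly the convolution of `c` with the barrier. As the
  -- convolution omits `k = n`, the constant `1` is not annihilated; it absorbs the initial layer of
  -- the truncation error.
  have hcmp := TSFPDE.discrete_comparison (E := fun n => TSFPDE.l2Norm Ω (e n))
    (y := fun n => V * (τ * K) * (1 + (n : ℝ) * τ)) (N := N) hc0 hcneg (by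
      intro n hn hnN
      have h0 : ∀ x ∈ frontier Ω, e n x = 0 := fun x hx => by
        simp only [he]
        rw [hu.boundary _ (hmem n hn hnN) x hx, hU.boundary n hn hnN x hx, sub_self]
      have hp : ∀ l, α l < 2 → TSFPDE.PartialZeroOnBoundary Ω l (e n) := fun l hl =>
        TSFPDE.PartialZeroOnBoundary.sub hΩ_open (hu.regular _ (hmem n hn hnN)).contDiffOn
          (hU.regular n hn hnN).contDiffOn (hu_grad _ (hmem n hn hnN) l) (hU_grad n hn hnN l hl)
      have hstep := TSFPDE.energy_step hn (fun m hm hmn => hLp m hm (hmn.trans hnN))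
        (TSFPDE.integrableOn_mul_spaceOp hΩ_open hΩ_bounded (hreg n hn hnN) εp εm)
        (TSFPDE.integral_mul_spaceOp_nonpos hΩ_open hΩ_convex hΩ_bounded hα hεp hεm
          (hreg n hn hnN) h0 hp) hcneg
        (ρ := τ * K * ∑ k ∈ Finset.range n, c k * (1 + ((n - k : ℕ) : ℝ) * τ))
        (mul_nonneg (mul_nonneg hτ.le hK0) (hconv0 n hn)) (by
          filter_upwards [MeasureTheory.ae_restrict_mem hΩ_open.measurableSet] with x hx
          have heq := TSFPDE.error_equation hΩ_open hΩ_convex hΩ_bounded hT hα hu hU hn hnN hx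
          refine (congrArg abs heq).trans_le ?_
          rw [hconv, Finset.mul_sum]
          refine (Finset.abs_sum_le_sum_abs _ _).trans (Finset.sum_le_sum fun r _ => ?_)
          rw [abs_mul, abs_of_nonneg (ha r), mul_left_comm]
          exact mul_le_mul_of_nonneg_left (TSFPDE.abs_gl_sub_caputo_le hT (hθ r).1 (hθ r).2
            (hu_time x hx) (hM x hx) (hP x hx) hτ hn (hnT n hnN)) (ha r))
      refine hstep.trans (le_of_eq ?_)
      congr 1
      rw [Finset.mul_sum, Finset.sum_mul]
      exact Finset.sum_congr rfl fun k _ => by ring)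
  intro n hn hnN
  refine (hcmp n hn hnN).trans ?_
  have := hnT n hnN
  calc V * (τ * K) * (1 + (n : ℝ) * τ) ≤ V * (τ * K) * (1 + T) := by gcongr
    _ = V * K * (1 + T) * τ := by ring
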